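/- We work in continuous first-order logic with truth values in $[0,1]$ (where $0$ is "true"). Let $\mathcal L$ be a (possibly many-sorted) metric continuous signature: function and predicate symbols, each with a modulus of uniform continuity in each argument, and a distance symbol on every sort. Fix a full system of continuous connectives, i.e. a family of continuous functions $[0,1]^n\to[0,1]$ ($n<\omega$) such that the closed system it generates under projections and composition is uniformly dense in $C([0,1]^n,[0,1])$ for all $n\ge 1$ (for instance $\{1-x,\ x/2,\ \max(x-y,0)\}$). Formulae are built with these connectives and the quantifiers $\inf$, $\sup$. $\mathcal L$-structures have non-empty sorts, which are complete metric spaces with distance at most $1$, and the symbols respect their moduli. Let $T$ be a (not necessarily complete) theory, i.e. a set of conditions $\theta=0$ with $\theta$ a sentence, let $|T|$ denote the number of $\mathcal L$-formulae, and let $\varphi(x,y)$ be a formula in two variables $x,y$, possibly of distinct sorts. - $\varphi$ is *stable* if for every $\varepsilon>0$ there is no model of $T$ containing an infinite sequence $(a_i,b_i)_{i<\omega}$ such that $|\varphi(a_i,b_j)-\varphi(a_j,b_i)|\ge\varepsilon$ for all $i<j$. - For a structure $M$, $\mathrm S_\varphi(M)$ (the space of *$\varphi$-types* over $M$) is the quotient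 of the space $\mathrm S_x(M)$ of complete types over $M$ in $x$ which identifies two types when they give the same value to $\varphi(x,b)$ for all $b\in M$. It is equipped with the metric $d(p,q)=\sup_{b\in M}|\varphi(x,b)^p-\varphi(x,b)^q|$, where $\varphi(x,b)^p$ is the value of $\varphi(x,b)$ according to $p$. - For a sequence $(a_n)$ in $[0,1]$, put $a'_0=a_0$ and let $a'_{n+1}$ be the point of $[a'_n-2^{-n-1},a'_n+2^{-n-1}]$ closest to $a_{n+1}$; the *forced limit* of $(a_n)$ is $\lim_n a'_n$. A $\varphi$-type $p\in\mathrm S_\varphi(M)$ is *definable* if there is an $M$-definable predicate $\psi(y)$, i.e. a forced limit of a sequence of formulae in $y$ with parameters in $M$, such that $\varphi(x,b)^p=\psi^M(b)$ for all $b\in M$. - $\|X\|$ is the density character of a metric space $X$ (the least cardinality of a dense subset), and $\|M\|$ is the sum of the density characters of the sorts of $M$. Then the following are equivalent: 1. $\varphi$ is stable. 2. For every $M\models T$, every $p\in\mathrm S_\varphi(M)$ is definable. 3. For every $M\models T$, $\|\mathrm S_\varphi(M)\|\le\|M\|$. 4. There exists a cardinal $\lambda\ge|T|$ such that, whenever $M\models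 T$ and $\|M\|\le\lambda$, also $\|\mathrm S_\varphi(M)\|\le\lambda$. -/

import Mathlib

open Set Filter Topology

universe u

namespace ContLogic

/-! ### Connectives -/

/-- A system of continuous connectives: for every `n`, a set of continuous functions
`[0,1]ⁿ → [0,1]`. -/
abbrev Connectives : Type := ∀ n : ℕ, Set C(Fin n → unitInterval, unitInterval)

/-- Membership in the closed system generated by `F`: it contains `F`, all the projections, and is
closed under composition. -/
inductive Connectives.Generated (F : Connectives) :
    ∀ n : ℕ, C(Fin n → unitInterval, unitInterval) → Prop
  | basic {n : ℕ} {c : C(Fin n → unitInterval, unitInterval)} (hc : c ∈ F n) :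
      Connectives.Generated F n c
  | proj {n : ℕ} (i : Fin n) :
      Connectives.Generated F n ⟨fun t => t i, continuous_apply i⟩
  | comp {n m : ℕ} {f : C(Fin n → unitInterval, unitInterval)}
      {g : Fin n → C(Fin m → unitInterval, unitInterval)}
      (hf : Connectives.Generated F n f) (hg : ∀ i, Connectives.Generated F m (g i)) :
      Connectives.Generated F m (f.comp (ContinuousMap.pi g))

/-- `F` is full if for every `n > 0` the `n`-ary members of the closed system it generates are
dense, for uniform convergence, in the set of all continuous functions `[0,1]ⁿ → [0,1]`. -/
def Connectives.Full (F : Connectives) : Prop :=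
  ∀ n : ℕ, 0 < n → Dense {c : C(Fin n → unitInterval, unitInterval) | F.Generated n c}

/-! ### Signatures, terms and formulae -/

/-- A (many-sorted, metric) continuous signature.  Every sort carries a distinguished distance
symbol, which is not listed among `Pred`.  `funMod f i`, `predMod P i` and `distMod s i` are
the uniform continuity moduli `(0,∞) → (0,∞)` of the symbols with respect to their `i`-th argument
(their values outside `(0,∞)` are irrelevant). -/
structure Signature where
  Srt : Type u
  Func : Type u
  funArity : Func → ℕ
  funDom : ∀ f : Func, Fin (funArity f) → Srt
  funCod : Func → Srt
  Pred : Type u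
  predArity : Pred → ℕ
  predDom : ∀ P : Pred, Fin (predArity P) → Srt
  funMod : ∀ f : Func, Fin (funArity f) → ℝ → ℝ
  funMod_pos : ∀ f i ε, 0 < ε → 0 < funMod f i ε
  predMod : ∀ P : Pred, Fin (predArity P) → ℝ → ℝ
  predMod_pos : ∀ P i ε, 0 < ε → 0 < predMod P i ε
  distMod : Srt → Fin 2 → ℝ → ℝ
  distMod_pos : ∀ s i ε, 0 < ε → 0 < distMod s i ε

/-- Terms whose variables are `x_i`, `i < n`, with `x_i` of sort `Γ i`. -/
inductive Term (L : Signature.{u}) {n : ℕ} (Γ : Fin n → L.Srt) : L.Srt → Type u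
  | var (i : Fin n) : Term L Γ (Γ i)
  | func (f : L.Func) (ts : ∀ i, Term L Γ (L.funDom f i)) : Term L Γ (L.funCod f)

/-- Formulae whose free variables are among `x_i`, `i < n`, with `x_i` of sort `Γ i`, built with
the connectives in `F`.  The quantifiers `inf` and `sup` bind the variable of index `0`. -/
inductive Formula (L : Signature.{u}) (F : Connectives) :
    ∀ {n : ℕ}, (Fin n → L.Srt) → Type u
  | dist {n : ℕ} {Γ : Fin n → L.Srt} {s : L.Srt} (t₁ t₂ : Term L Γ s) : Formula L F Γ
  | pred {n : ℕ} {Γ : Fin n → L.Srt} (P : L.Pred) (ts : ∀ i, Term L Γ (L.predDom P i)) :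
      Formula L F Γ
  | conn {n : ℕ} {Γ : Fin n → L.Srt} {k : ℕ} (c : F k) (ψ : Fin k → Formula L F Γ) :
      Formula L F Γ
  | inf {n : ℕ} {Γ : Fin n → L.Srt} (s : L.Srt) (ψ : Formula L F (Matrix.vecCons s Γ)) :
      Formula L F Γ
  | sup {n : ℕ} {Γ : Fin n → L.Srt} (s : L.Srt) (ψ : Formula L F (Matrix.vecCons s Γ)) :
      Formula L F Γ

/-- Sentences: formulae without free variables. -/
abbrev Sentence (L : Signature.{u}) (F : Connectives) : Type u :=
  Formula L F (![] : Fin 0 → L.Srt)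

/-- A theory is a set of sentential conditions `φ = 0`; the set `T` of sentences stands for
`{φ = 0 : φ ∈ T}`. -/
abbrev Theory (L : Signature.{u}) (F : Connectives) : Type u := Set (Sentence L F)

/-- The cardinality of the language, i.e. the number of formulae.  (For a countable system of
connectives this is the number of sorts and symbols plus `ℵ₀`.)  As usual, for a theory `T` in
this language, `|T|` denotes this cardinal. -/
noncomputable def langCard (L : Signature.{u}) (F : Connectives) : Cardinal.{u} :=
  Cardinal.mk (Σ n : ℕ, Σ Γ : Fin n → L.Srt, Formula L F Γ)

/-! ### Structures -/

/-- A continuous `L`-structure: every sort is a non-empty complete metric space with values of the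
distance in `[0,1]`, and the symbols are interpreted respecting their continuity moduli. -/
structure Structure (L : Signature.{u}) where
  carrier : L.Srt → Type u
  [metric : ∀ s, MetricSpace (carrier s)]
  [complete : ∀ s, CompleteSpace (carrier s)]
  [nonempty : ∀ s, Nonempty (carrier s)]
  dist_le_one : ∀ (s : L.Srt) (a b : carrier s), dist a b ≤ 1
  funMap : ∀ f : L.Func, (∀ i, carrier (L.funDom f i)) → carrier (L.funCod f)
  predMap : ∀ P : L.Pred, (∀ i, carrier (L.predDom P i)) → unitInterval
  funMap_unif : ∀ (f : L.Func) (i : Fin (L.funArity f)) (ε : ℝ), 0 < ε →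
    ∀ v w : ∀ j, carrier (L.funDom f j), (∀ j, j ≠ i → v j = w j) →
      dist (v i) (w i) < L.funMod f i ε → dist (funMap f v) (funMap f w) ≤ ε
  predMap_unif : ∀ (P : L.Pred) (i : Fin (L.predArity P)) (ε : ℝ), 0 < ε →
    ∀ v w : ∀ j, carrier (L.predDom P j), (∀ j, j ≠ i → v j = w j) →
      dist (v i) (w i) < L.predMod P i ε → dist (predMap P v) (predMap P w) ≤ ε
  dist_unif_left : ∀ (s : L.Srt) (ε : ℝ), 0 < ε → ∀ a a' b : carrier s,
    dist a a' < L.distMod s 0 ε → |dist a b - dist a' b| ≤ ε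
  dist_unif_right : ∀ (s : L.Srt) (ε : ℝ), 0 < ε → ∀ a b b' : carrier s,
    dist b b' < L.distMod s 1 ε → |dist a b - dist a b'| ≤ ε

attribute [instance] Structure.metric Structure.complete Structure.nonempty

variable {L : Signature.{u}} {F : Connectives}

/-- Tuples of elements of `M` of the sorts prescribed by `Γ`. -/
abbrev Structure.Tuple (M : Structure L) {n : ℕ} (Γ : Fin n → L.Srt) : Type u :=
  ∀ i, M.carrier (Γ i)

/-- The tuple `v` with `a` added in front. -/
def Structure.cons (M : Structure L) {n : ℕ} {Γ : Fin n → L.Srt} {s : L.Srt}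
    (a : M.carrier s) (v : M.Tuple Γ) : M.Tuple (Matrix.vecCons s Γ) :=
  Fin.cons (α := fun i => M.carrier (Matrix.vecCons s Γ i)) a v

/-- The empty tuple. -/
def Structure.nil (M : Structure L) : M.Tuple (![] : Fin 0 → L.Srt) := fun i => i.elim0

/-- Interpretation of a term. -/
def Term.realize (M : Structure L) {n : ℕ} {Γ : Fin n → L.Srt} (v : M.Tuple Γ) :
    ∀ {s : L.Srt}, Term L Γ s → M.carrier s
  | _, .var i => v i
  | _, .func f ts => M.funMap f fun i => (ts i).realize M v

/-- Interpretation of a formula; the truth values are in `[0,1]`. -/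
noncomputable def Formula.realize (M : Structure L) :
    ∀ {n : ℕ} {Γ : Fin n → L.Srt}, Formula L F Γ → M.Tuple Γ → unitInterval
  | _, _, .dist t₁ t₂, v =>
      ⟨Dist.dist (t₁.realize M v) (t₂.realize M v), dist_nonneg, M.dist_le_one _ _ _⟩
  | _, _, .pred P ts, v => M.predMap P fun i => (ts i).realize M v
  | _, _, .conn c ψ, v => c.1 fun i => (ψ i).realize M v
  | _, _, .inf s ψ, v => ⨅ a : M.carrier s, ψ.realize M (M.cons a v)
  | _, _, .sup s ψ, v => ⨆ a : M.carrier s, ψ.realize M (M.cons a v)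

/-- `M` is a model of `T`. -/
def Structure.Models (M : Structure L) (T : Theory L F) : Prop :=
  ∀ φ ∈ T, φ.realize M M.nil = 0

/-- The value `φ(a,b)` of a formula in two variables. -/
noncomputable def Formula.val₂ {σ τ : L.Srt} (φ : Formula L F ![σ, τ]) (M : Structure L)
    (a : M.carrier σ) (b : M.carrier τ) : unitInterval :=
  φ.realize M (M.cons a (M.cons b M.nil))

/-- An elementary embedding of `M` in `N`: it preserves the truth values of all formulae. -/
structure ElemEmbedding (F : Connectives) (M N : Structure L) where
  toFun : ∀ s, M.carrier s → N.carrier s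
  map_formula : ∀ {n : ℕ} {Γ : Fin n → L.Srt} (φ : Formula L F Γ) (v : M.Tuple Γ),
    φ.realize N (fun i => toFun _ (v i)) = φ.realize M v

/-! ### Density character -/

/-- The density character of a topological space: the least cardinality of a dense subset. -/
noncomputable def density (X : Type u) [TopologicalSpace X] : Cardinal.{u} :=
  sInf {κ | ∃ D : Set X, Dense D ∧ Cardinal.mk D = κ}

/-- `‖M‖`: the density character of (the disjoint union of the sorts of) `M`. -/
noncomputable def Structure.density (M : Structure L) : Cardinal.{u} :=
  Cardinal.sum fun s => ContLogic.density (M.carrier s)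

/-! ### Types and definable predicates over a structure -/

/-- A formula `θ(x, m̄)` in one variable `x` of sort `σ` with parameters `m̄` in `M`. -/
structure ParamFormula (F : Connectives) (M : Structure L) (σ : L.Srt) where
  n : ℕ
  Γ : Fin n → L.Srt
  formula : Formula L F (Matrix.vecCons σ Γ)
  params : M.Tuple Γ

/-- The value at `a ∈ M` of a formula with parameters in `M`. -/
noncomputable def ParamFormula.eval {M : Structure L} {σ : L.Srt} (θ : ParamFormula F M σ)
    (a : M.carrier σ) : unitInterval :=
  θ.formula.realize M (M.cons a θ.params)

/-- The value of a formula with parameters in `M` at an element of an elementary extension. -/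
noncomputable def ParamFormula.evalExt {M N : Structure L} {σ : L.Srt} (θ : ParamFormula F M σ)
    (e : ElemEmbedding F M N) (a : N.carrier σ) : unitInterval :=
  θ.formula.realize N (N.cons a fun i => e.toFun _ (θ.params i))

/-- The space `S_x(M)` of complete types over `M` in a variable `x` of sort `σ`.  A complete type
`p` is given by the values `θ^p` of all formulae `θ(x)` with parameters in `M`, and these families
of values are exactly those realised by elements of elementary extensions of `M`. -/
def TypeOver (F : Connectives) (M : Structure L) (σ : L.Srt) : Type u :=
  {p : ParamFormula F M σ → unitInterval //
    ∃ (N : Structure L) (e : ElemEmbedding F M N) (a : N.carrier σ), ∀ θ, p θ = θ.evalExt e a}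

/-- The instance `φ(x,b)`, `b ∈ M`, as a formula with parameters in `M`. -/
def Formula.inst {σ τ : L.Srt} (φ : Formula L F ![σ, τ]) (M : Structure L) (b : M.carrier τ) :
    ParamFormula F M σ where
  n := 1
  Γ := ![τ]
  formula := φ
  params := M.cons b M.nil

/-- Two complete types over `M` are identified if they agree on all instances `φ(x,b)`, `b ∈ M`. -/
def phiSetoid {σ τ : L.Srt} (φ : Formula L F ![σ, τ]) (M : Structure L) :
    Setoid (TypeOver F M σ) where
  r p q := ∀ b : M.carrier τ, p.1 (φ.inst M b) = q.1 (φ.inst M b)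
  iseqv := ⟨fun _ _ => rfl, fun h b => (h b).symm, fun h₁ h₂ b => (h₁ b).trans (h₂ b)⟩

/-- The space `S_φ(M)` of (complete) `φ`-types over `M`. -/
def PhiType {σ τ : L.Srt} (φ : Formula L F ![σ, τ]) (M : Structure L) : Type u :=
  Quotient (phiSetoid φ M)

namespace PhiType

variable {σ τ : L.Srt} {φ : Formula L F ![σ, τ]} {M : Structure L}

/-- The value `φ(x,b)^p` of the instance `φ(x,b)` according to the `φ`-type `p`. -/
def val (p : PhiType φ M) (b : M.carrier τ) : unitInterval :=
  Quotient.lift (s := phiSetoid φ M) (fun p : TypeOver F M σ => p.1 (φ.inst M b))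
    (fun _ _ h => h b) p

theorem val_injective : Function.Injective (val : PhiType φ M → M.carrier τ → unitInterval) := by
  intro p q
  refine Quotient.inductionOn₂ p q fun p q h => ?_
  exact Quotient.sound (s := phiSetoid φ M) fun b => congrFun h b

theorem bddAbove_dist (p q : PhiType φ M) :
    BddAbove (range fun b : M.carrier τ => dist (p.val b) (q.val b)) := by
  refine ⟨1, ?_⟩
  rintro _ ⟨b, rfl⟩
  show dist (p.val b) (q.val b) ≤ 1
  rw [Subtype.dist_eq, Real.dist_eq, abs_le]
  constructor <;> linarith [(p.val b).2.1, (p.val b).2.2, (q.val b).2.1, (q.val b).2.2]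

/-- The metric `d(p,q) = sup_{b ∈ M} |φ(x,b)^p - φ(x,b)^q|` on the space of `φ`-types. -/
noncomputable instance : MetricSpace (PhiType φ M) where
  dist p q := ⨆ b : M.carrier τ, dist (p.val b) (q.val b)
  dist_self p := by simp
  dist_comm p q := by simp only [dist_comm]
  dist_triangle p q r := by
    refine ciSup_le fun b => (dist_triangle _ (q.val b) _).trans ?_
    exact add_le_add (le_ciSup (bddAbove_dist p q) b) (le_ciSup (bddAbove_dist q r) b)
  eq_of_dist_eq_zero := by
    intro p q h
    apply val_injective
    funext b
    exact dist_le_zero.1 ((le_ciSup (bddAbove_dist p q) b).trans_eq h)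

end PhiType

/-- The modified sequence in the definition of the forced limit: `a'₀ = a₀`, and `a'ₙ₊₁` is the
point of the interval `[a'ₙ - 2⁻ⁿ⁻¹, a'ₙ + 2⁻ⁿ⁻¹]` closest to `aₙ₊₁`. -/
noncomputable def forcedSeq (a : ℕ → ℝ) : ℕ → ℝ
  | 0 => a 0
  | n + 1 => max (forcedSeq a n - (1 / 2) ^ (n + 1))
      (min (forcedSeq a n + (1 / 2) ^ (n + 1)) (a (n + 1)))

/-- The forced limit of a sequence. -/
noncomputable def forcedLim (a : ℕ → ℝ) : ℝ := limUnder atTop (forcedSeq a)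

/-- The modified sequence always converges, so that the forced limit is a genuine limit. -/
theorem tendsto_forcedSeq (a : ℕ → ℝ) : Tendsto (forcedSeq a) atTop (𝓝 (forcedLim a)) := by
  apply CauchySeq.tendsto_limUnder
  refine cauchySeq_of_le_geometric (1 / 2) (1 / 2) (by norm_num) fun n => ?_
  have h : (0 : ℝ) < (1 / 2) ^ (n + 1) := by positivity
  rw [dist_comm, Real.dist_eq, ← pow_succ', abs_le, forcedSeq]
  constructor
  · linarith [le_max_left (forcedSeq a n - (1 / 2) ^ (n + 1))
      (min (forcedSeq a n + (1 / 2) ^ (n + 1)) (a (n + 1)))]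
  · rw [sub_le_iff_le_add, max_le_iff]
    constructor
    · linarith
    · exact (min_le_left _ _).trans (by linarith)

/-- An `M`-definable predicate in one variable `y` of sort `τ` is a forced limit of a sequence of
formulae with parameters in `M`.  A `φ`-type `p` over `M` is definable if there is an `M`-definable
predicate `ψ(y)` such that `φ(x,b)^p = ψ(b)` for all `b ∈ M`. -/
def PhiType.IsDefinable {σ τ : L.Srt} {φ : Formula L F ![σ, τ]} {M : Structure L}
    (p : PhiType φ M) : Prop :=
  ∃ ψ : ℕ → ParamFormula F M τ, ∀ b : M.carrier τ,
    (p.val b : ℝ) = forcedLim fun n => ((ψ n).eval b : ℝ)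

/-! ### Stability -/

/-- `φ(x,y)` is `ε`-stable in `T`: no model of `T` contains an infinite sequence `(aᵢ, bᵢ)` with
`|φ(aᵢ,bⱼ) - φ(aⱼ,bᵢ)| ≥ ε` for all `i < j`. -/
def EpsStable (T : Theory L F) {σ τ : L.Srt} (φ : Formula L F ![σ, τ]) (ε : ℝ) : Prop :=
  ∀ M : Structure L, M.Models T →
    ¬ ∃ (a : ℕ → M.carrier σ) (b : ℕ → M.carrier τ), ∀ i j : ℕ, i < j →
      ε ≤ |(φ.val₂ M (a i) (b j) : ℝ) - (φ.val₂ M (a j) (b i) : ℝ)|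

/-- `φ(x,y)` is stable in `T`. -/
def Stable (T : Theory L F) {σ τ : L.Srt} (φ : Formula L F ![σ, τ]) : Prop :=
  ∀ ε : ℝ, 0 < ε → EpsStable T φ ε

end ContLogic

/-! Under stability, each type is a uniform limit of continuous functions of finitely many
instances. Let `p` be a `φ`-type over a model `M`, and suppose that for some `ε` no finite set of
values `φ(c,b)` determines `φ(x,b)^p` up to `ε`. Alternately choose `b, b'` that the earlier `c`'s
do not separate but `p` does, and a new `c` that approximates `p` on the earlier `b`'s. Ramsey's
theorem extracts a sequence violating stability from the resulting triples (`Stable.exists_finset`).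
Hence `p` is, up to `ε`, a continuous connective applied to some `φ(c_i,y)` with `c_i` in any
prescribed dense set (`Stable.exists_conn`). This gives 1 ⇒ 2: by fullness the connective is
approximated by formulae, and fast approximation makes the forced limit an ordinary limit. It also
gives 1 ⇒ 3: up to `ε`, a type is coded by a finite tuple from a dense set and a member of a
countable dense set of connectives. The size of the language plays no role there. For 2 ⇒ 4, a
forced limit is determined up to `2⁻ⁿ` by its first `n + 1` terms, whose parameters may be moved
into dense sets; so there are few definable types up to `ε`. Clearly 3 ⇒ 4, with `λ = |T|`. For 4 ⇒
1, Ramsey's theorem turns instability into a sequence with `φ(a_i,b_j)` near `r` and `φ(a_j,b_i)`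
near `s` for `i < j`, where `r` and `s` are far apart. An ultrapower spreads this pattern along any
infinite linear order (`exists_model_order`). Take an order in which more than `λ` points are
separated by at most `λ` points (`exists_linearOrder_separated`). The downward Löwenheim–Skolem
theorem yields a model of density at most `λ` containing the separating `b`'s, and over it the many
`a`'s have uniformly separated `φ`-types. -/

namespace ContLogic

variable {L : Signature.{u}} {F : Connectives}

/-! ### Substitution and connectives -/

/-- Substitution of terms for the variables of a term. -/
def Term.subst {n m : ℕ} {Γ : Fin n → L.Srt} {Δ : Fin m → L.Srt} (ρ : ∀ i, Term L Δ (Γ i)) :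
    ∀ {s : L.Srt}, Term L Γ s → Term L Δ s
  | _, .var i => ρ i
  | _, .func f ts => .func f fun i => (ts i).subst ρ

/-- The substitution that extends `ρ` under a quantifier. -/
def Term.lift {n m : ℕ} {Γ : Fin n → L.Srt} {Δ : Fin m → L.Srt} (s : L.Srt)
    (ρ : ∀ i, Term L Δ (Γ i)) :
    ∀ i, Term L (Matrix.vecCons s Δ) (Matrix.vecCons s Γ i) :=
  Fin.cons (α := fun i => Term L (Matrix.vecCons s Δ) (Matrix.vecCons s Γ i))
    (Term.var (Γ := Matrix.vecCons s Δ) 0)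
    fun i => (ρ i).subst fun j => Term.var (Γ := Matrix.vecCons s Δ) j.succ

/-- Substitution of terms for the free variables of a formula. -/
def Formula.subst : ∀ {n m : ℕ} {Γ : Fin n → L.Srt} {Δ : Fin m → L.Srt}
    (_ : ∀ i, Term L Δ (Γ i)), Formula L F Γ → Formula L F Δ
  | _, _, _, _, ρ, .dist t₁ t₂ => .dist (t₁.subst ρ) (t₂.subst ρ)
  | _, _, _, _, ρ, .pred P ts => .pred P fun i => (ts i).subst ρ
  | _, _, _, _, ρ, .conn c ψ => .conn c fun i => (ψ i).subst ρ
  | _, _, _, _, ρ, .inf s ψ => .inf s (ψ.subst (Term.lift s ρ))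
  | _, _, _, _, ρ, .sup s ψ => .sup s (ψ.subst (Term.lift s ρ))

theorem Term.realize_subst (M : Structure L) {n m : ℕ} {Γ : Fin n → L.Srt} {Δ : Fin m → L.Srt}
    (ρ : ∀ i, Term L Δ (Γ i)) (v : M.Tuple Δ) {s : L.Srt} (t : Term L Γ s) :
    (t.subst ρ).realize M v = t.realize M fun i => (ρ i).realize M v := by
  induction t with
  | var i => rfl
  | func f ts ih => simp only [Term.subst, Term.realize, ih]

theorem Term.realize_lift (M : Structure L) {n m : ℕ} {Γ : Fin n → L.Srt} {Δ : Fin m → L.Srt}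
    (ρ : ∀ i, Term L Δ (Γ i)) (v : M.Tuple Δ) {s : L.Srt} (a : M.carrier s) :
    (fun i => (Term.lift s ρ i).realize M (M.cons a v)) =
      M.cons a fun i => (ρ i).realize M v := by
  funext i
  refine Fin.cases ?_ (fun i => ?_) i
  · rfl
  · exact Term.realize_subst M _ _ (ρ i)

theorem Formula.realize_subst (M : Structure L) {n m : ℕ} {Γ : Fin n → L.Srt}
    {Δ : Fin m → L.Srt} (ρ : ∀ i, Term L Δ (Γ i)) (v : M.Tuple Δ) (ψ : Formula L F Γ) :
    (ψ.subst ρ).realize M v = ψ.realize M fun i => (ρ i).realize M v := by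
  induction ψ generalizing m with
  | dist t₁ t₂ => simp only [Formula.subst, Formula.realize, Term.realize_subst]
  | pred P ts => simp only [Formula.subst, Formula.realize, Term.realize_subst]
  | conn c ψ ih => simp only [Formula.subst, Formula.realize, ih]
  | inf s ψ ih => simp only [Formula.subst, Formula.realize, ih, Term.realize_lift]
  | sup s ψ ih => simp only [Formula.subst, Formula.realize, ih, Term.realize_lift]

/-- Generated connectives can be applied to formulae. -/
theorem Connectives.Generated.exists_formula {k : ℕ}
    {c : C(Fin k → unitInterval, unitInterval)} (hc : F.Generated k c) {n : ℕ}
    {Γ : Fin n → L.Srt} (ψ : Fin k → Formula L F Γ) :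
    ∃ χ : Formula L F Γ, ∀ (M : Structure L) (v : M.Tuple Γ),
      χ.realize M v = c fun i => (ψ i).realize M v := by
  induction hc with
  | basic hc => exact ⟨.conn ⟨_, hc⟩ ψ, fun M v => rfl⟩
  | proj i => exact ⟨ψ i, fun M v => rfl⟩
  | comp hf hg ihf ihg =>
    choose χ hχ using fun i => ihg i ψ
    obtain ⟨ξ, hξ⟩ := ihf χ
    refine ⟨ξ, fun M v => ?_⟩
    rw [hξ]
    simp only [hχ]
    rfl

/-- In a full system, every continuous connective is approximated by formulae. -/
theorem Connectives.Full.exists_formula (hF : F.Full) {k : ℕ} (hk : 0 < k)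
    (g : C(Fin k → unitInterval, unitInterval)) {ε : ℝ} (hε : 0 < ε) {n : ℕ}
    {Γ : Fin n → L.Srt} (ψ : Fin k → Formula L F Γ) :
    ∃ χ : Formula L F Γ, ∀ (M : Structure L) (v : M.Tuple Γ),
      |(χ.realize M v : ℝ) - g fun i => (ψ i).realize M v| < ε := by
  obtain ⟨c, hc, hcg⟩ := (hF k hk).exists_dist_lt g hε
  obtain ⟨χ, hχ⟩ := Connectives.Generated.exists_formula hc ψ
  refine ⟨χ, fun M v => ?_⟩
  rw [hχ, abs_sub_comm, ← Real.dist_eq, ← Subtype.dist_eq]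
  exact (ContinuousMap.dist_apply_le_dist _).trans_lt hcg

/-- `φ(x, y₀)` with `x` and `y₀` substituted by variables. -/
def Formula.subst₂ {σ τ : L.Srt} (φ : Formula L F ![σ, τ]) {n : ℕ} {Γ : Fin n → L.Srt}
    (s : Term L Γ σ) (t : Term L Γ τ) : Formula L F Γ :=
  φ.subst (Fin.cons (α := fun i => Term L Γ (![σ, τ] i)) s
    (Fin.cons (α := fun i => Term L Γ (![τ] i)) t fun i => i.elim0))

theorem Formula.realize_subst₂ {σ τ : L.Srt} (φ : Formula L F ![σ, τ]) {n : ℕ}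
    {Γ : Fin n → L.Srt} (s : Term L Γ σ) (t : Term L Γ τ) (M : Structure L) (v : M.Tuple Γ) :
    (φ.subst₂ s t).realize M v = φ.val₂ M (s.realize M v) (t.realize M v) := by
  rw [Formula.subst₂, Formula.realize_subst, Formula.val₂]
  congr 1
  funext i
  refine Fin.cases rfl (fun i => ?_) i
  refine Fin.cases rfl (fun i => i.elim0) i

/-! ### Uniform continuity -/

/-- A map on a finite product that is uniformly continuous in each coordinate, uniformly in the
others, is uniformly continuous. -/
theorem uniformContinuous_pi_of_coord {n : ℕ} {X : Fin n → Type*} [∀ i, PseudoMetricSpace (X i)]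
    {Y : Type*} [PseudoMetricSpace Y] (f : (∀ i, X i) → Y)
    (h : ∀ i, ∀ ε > 0, ∃ δ > 0, ∀ v w : ∀ j, X j, (∀ j, j ≠ i → v j = w j) →
      dist (v i) (w i) < δ → dist (f v) (f w) ≤ ε) : UniformContinuous f := by
  classical
  -- Induction on the set of coordinates allowed to change, moving one coordinate at a time.
  have key : ∀ s : Finset (Fin n), ∀ ε > 0, ∃ δ > 0, ∀ v w : ∀ j, X j, (∀ j, j ∉ s → v j = w j) →
      (∀ j ∈ s, dist (v j) (w j) < δ) → dist (f v) (f w) ≤ ε := by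
    intro s
    induction s using Finset.induction_on with
    | empty =>
      intro ε hε
      refine ⟨1, one_pos, fun v w hvw _ => ?_⟩
      rw [funext fun j => hvw j (by simp), dist_self]
      exact hε.le
    | insert i s hi ih =>
      intro ε hε
      obtain ⟨δ₁, hδ₁, h₁⟩ := ih (ε / 2) (half_pos hε)
      obtain ⟨δ₂, hδ₂, h₂⟩ := h i (ε / 2) (half_pos hε)
      refine ⟨min δ₁ δ₂, lt_min hδ₁ hδ₂, fun v w hvw hd => ?_⟩
      have e₁ := h₂ v (Function.update v i (w i)) (fun j hj => by simp [hj]) (by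
        simpa using (hd i (by simp)).trans_le (min_le_right _ _))
      have e₂ := h₁ (Function.update v i (w i)) w (fun j hj => by
        by_cases hji : j = i
        · subst hji; simp
        · simpa [hji] using hvw j (by simp [hji, hj])) (fun j hj => by
        have hji : j ≠ i := fun e => hi (e ▸ hj)
        simpa [hji] using (hd j (by simp [hj])).trans_le (min_le_left _ _))
      linarith [dist_triangle (f v) (f (Function.update v i (w i))) (f w)]
  rw [Metric.uniformContinuous_iff]
  intro ε hε
  obtain ⟨δ, hδ, hk⟩ := key Finset.univ (ε / 2) (half_pos hε)
  refine ⟨δ, hδ, fun v w hvw => ?_⟩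
  refine (hk v w (fun j hj => absurd (Finset.mem_univ j) hj) fun j _ => ?_).trans_lt
    (half_lt_self hε)
  exact (dist_le_pi_dist v w j).trans_lt hvw

theorem Structure.uniformContinuous_funMap (M : Structure L) (f : L.Func) :
    UniformContinuous (M.funMap f) :=
  uniformContinuous_pi_of_coord _ fun i ε hε =>
    ⟨_, L.funMod_pos f i ε hε, M.funMap_unif f i ε hε⟩

theorem Structure.uniformContinuous_predMap (M : Structure L) (P : L.Pred) :
    UniformContinuous (M.predMap P) :=
  uniformContinuous_pi_of_coord _ fun i ε hε =>
    ⟨_, L.predMod_pos P i ε hε, M.predMap_unif P i ε hε⟩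

theorem Term.uniformContinuous_realize (M : Structure L) {n : ℕ} {Γ : Fin n → L.Srt}
    {s : L.Srt} (t : Term L Γ s) : UniformContinuous fun v : M.Tuple Γ => t.realize M v := by
  induction t with
  | var i => exact Pi.uniformContinuous_proj _ i
  | func f ts ih =>
    exact (M.uniformContinuous_funMap f).comp (uniformContinuous_pi.2 ih)

theorem Structure.dist_cons_cons (M : Structure L) {n : ℕ} {Γ : Fin n → L.Srt} {s : L.Srt}
    (a : M.carrier s) (v w : M.Tuple Γ) : dist (M.cons a v) (M.cons a w) ≤ dist v w := by
  refine (dist_pi_le_iff dist_nonneg).2 fun i => ?_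
  refine Fin.cases ?_ (fun i => ?_) i
  · exact (dist_self a).trans_le dist_nonneg
  · exact dist_le_pi_dist v w i

theorem dist_iInf_le {ι : Type*} [Nonempty ι] {f g : ι → unitInterval} {ε : ℝ}
    (h : ∀ i, dist (f i) (g i) ≤ ε) : dist (⨅ i, f i) (⨅ i, g i) ≤ ε := by
  have key : ∀ f g : ι → unitInterval, (∀ i, dist (f i) (g i) ≤ ε) →
      ((⨅ i, f i : unitInterval) : ℝ) ≤ (⨅ i, g i : unitInterval) + ε := by
    intro f g h
    refine le_of_forall_pos_lt_add fun η hη => ?_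
    by_contra! hc
    -- The contradictory assumption `hc` keeps the bound inside `[0,1]`, so that it can be compared
    -- with the infimum there.
    have hx : ((⨅ i, g i : unitInterval) : ℝ) + η ≤ 1 := by
      have h0 := dist_nonneg.trans (h (Classical.arbitrary ι))
      linarith [(⨅ i, f i : unitInterval).2.2]
    have hlt : (⨅ i, g i) < (⟨(⨅ i, g i : unitInterval) + η,
        add_nonneg (⨅ i, g i : unitInterval).2.1 hη.le, hx⟩ : unitInterval) := by
      rw [← Subtype.coe_lt_coe]; simpa using hη
    obtain ⟨i, hi⟩ := iInf_lt_iff.1 hlt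
    have h1 : ((⨅ i, f i : unitInterval) : ℝ) ≤ f i := iInf_le f i
    have h2 : (g i : ℝ) < (⨅ i, g i : unitInterval) + η := hi
    have h3 := h i
    rw [Subtype.dist_eq, Real.dist_eq, abs_le] at h3
    linarith
  rw [Subtype.dist_eq, Real.dist_eq, abs_le]
  constructor
  · linarith [key g f fun i => by rw [dist_comm]; exact h i]
  · linarith [key f g h]

theorem symm_iSup {ι : Type*} (f : ι → unitInterval) :
    unitInterval.symm (⨆ i, f i) = ⨅ i, unitInterval.symm (f i) := by
  apply le_antisymm
  · exact le_iInf fun i => unitInterval.symm_le_symm.2 (le_iSup f i)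
  · rw [unitInterval.le_symm_comm]
    exact iSup_le fun i => unitInterval.le_symm_comm.1 (iInf_le _ i)

theorem dist_symm_symm (a b : unitInterval) :
    dist (unitInterval.symm a) (unitInterval.symm b) = dist a b := by
  rw [Subtype.dist_eq, Subtype.dist_eq, Real.dist_eq, Real.dist_eq, abs_sub_comm]
  congr 1
  simp

theorem dist_iSup_le {ι : Type*} [Nonempty ι] {f g : ι → unitInterval} {ε : ℝ}
    (h : ∀ i, dist (f i) (g i) ≤ ε) : dist (⨆ i, f i) (⨆ i, g i) ≤ ε := by
  rw [← dist_symm_symm, symm_iSup, symm_iSup]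
  exact dist_iInf_le fun i => by rw [dist_symm_symm]; exact h i

/-- Infimum and supremum are 1-Lipschitz for the uniform distance, and adding the same bound element
to two tuples does not increase their distance. So a modulus for the body, taken at `ε / 2`, serves
for the quantified formula. -/
theorem Formula.uniformContinuous_realize (M : Structure L) {n : ℕ} {Γ : Fin n → L.Srt}
    (ψ : Formula L F Γ) : UniformContinuous fun v : M.Tuple Γ => ψ.realize M v := by
  induction ψ with
  | dist t₁ t₂ =>
    exact UniformContinuous.subtype_mk
      ((t₁.uniformContinuous_realize M).dist (t₂.uniformContinuous_realize M)) _
  | pred P ts =>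
    exact (M.uniformContinuous_predMap P).comp
      (uniformContinuous_pi.2 fun i => (ts i).uniformContinuous_realize M)
  | conn c ψ ih =>
    exact (CompactSpace.uniformContinuous_of_continuous c.1.continuous).comp
      (uniformContinuous_pi.2 ih)
  | inf s ψ ih =>
    rw [Metric.uniformContinuous_iff] at ih ⊢
    intro ε hε
    obtain ⟨δ, hδ, h⟩ := ih (ε / 2) (half_pos hε)
    refine ⟨δ, hδ, fun {v w} hvw => ?_⟩
    exact (dist_iInf_le fun a => (h ((M.dist_cons_cons a v w).trans_lt hvw)).le).trans_lt
      (half_lt_self hε)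
  | sup s ψ ih =>
    rw [Metric.uniformContinuous_iff] at ih ⊢
    intro ε hε
    obtain ⟨δ, hδ, h⟩ := ih (ε / 2) (half_pos hε)
    refine ⟨δ, hδ, fun {v w} hvw => ?_⟩
    exact (dist_iSup_le fun a => (h ((M.dist_cons_cons a v w).trans_lt hvw)).le).trans_lt
      (half_lt_self hε)

theorem Structure.continuous_cons_left (M : Structure L) {n : ℕ} {Γ : Fin n → L.Srt} {s : L.Srt}
    (v : M.Tuple Γ) : Continuous fun a : M.carrier s => M.cons a v := by
  refine continuous_pi fun i => ?_
  refine Fin.cases ?_ (fun i => ?_) i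
  · exact continuous_id
  · exact continuous_const

theorem Formula.continuous_val₂_left {σ τ : L.Srt} (φ : Formula L F ![σ, τ]) (M : Structure L)
    (b : M.carrier τ) : Continuous fun a => φ.val₂ M a b :=
  (φ.uniformContinuous_realize M).continuous.comp (M.continuous_cons_left _)

/-! ### Finite satisfiability of types -/

theorem dist_unitInterval_le_one (a b : unitInterval) : dist a b ≤ 1 := by
  rw [Subtype.dist_eq, Real.dist_eq, abs_le]
  constructor <;> linarith [a.2.1, a.2.2, b.2.1, b.2.2]

/-- The distance to a point of the cube, as a connective. -/
noncomputable def distConn {k : ℕ} (t₀ : Fin k → unitInterval) :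
    C(Fin k → unitInterval, unitInterval) where
  toFun t := ⟨dist t t₀, dist_nonneg,
    (dist_pi_le_iff zero_le_one).2 fun _ => dist_unitInterval_le_one _ _⟩
  continuous_toFun := by fun_prop

theorem Formula.evalExt_inst {σ τ : L.Srt} (φ : Formula L F ![σ, τ]) {M N : Structure L}
    (e : ElemEmbedding F M N) (a : N.carrier σ) (b : M.carrier τ) :
    (φ.inst M b).evalExt e a = φ.val₂ N a (e.toFun τ b) := by
  have h : (fun i => e.toFun (![τ] i) (M.cons b M.nil i)) = N.cons (e.toFun τ b) N.nil := by
    funext i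
    exact Fin.cases rfl (fun i => i.elim0) i
  exact congrArg (fun v => φ.realize N (N.cons a v)) h

theorem PhiType.exists_realization {σ τ : L.Srt} {φ : Formula L F ![σ, τ]} {M : Structure L}
    (p : PhiType φ M) : ∃ (N : Structure L) (e : ElemEmbedding F M N) (a : N.carrier σ),
      ∀ b, p.val b = φ.val₂ N a (e.toFun τ b) := by
  obtain ⟨⟨q, N, e, a, h⟩, rfl⟩ := Quotient.exists_rep (s := phiSetoid φ M) p
  exact ⟨N, e, a, fun b => (h _).trans (φ.evalExt_inst e a b)⟩

/-- The `φ`-type over `M` of an element of an elementary extension. -/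
noncomputable def PhiType.ofExt {σ τ : L.Srt} (φ : Formula L F ![σ, τ]) {M N : Structure L}
    (e : ElemEmbedding F M N) (a : N.carrier σ) : PhiType φ M :=
  Quotient.mk (phiSetoid φ M) ⟨fun θ => θ.evalExt e a, N, e, a, fun _ => rfl⟩

theorem PhiType.val_ofExt {σ τ : L.Srt} (φ : Formula L F ![σ, τ]) {M N : Structure L}
    (e : ElemEmbedding F M N) (a : N.carrier σ) (b : M.carrier τ) :
    (PhiType.ofExt φ e a).val b = φ.val₂ N a (e.toFun τ b) :=
  φ.evalExt_inst e a b

theorem PhiType.dist_val_le {σ τ : L.Srt} {φ : Formula L F ![σ, τ]} {M : Structure L}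
    (p q : PhiType φ M) (b : M.carrier τ) : dist (p.val b) (q.val b) ≤ dist p q :=
  le_ciSup (PhiType.bddAbove_dist p q) b

theorem PhiType.dist_le {σ τ : L.Srt} {φ : Formula L F ![σ, τ]} {M : Structure L}
    {p q : PhiType φ M} {r : ℝ} (h : ∀ b, dist (p.val b) (q.val b) ≤ r) : dist p q ≤ r :=
  ciSup_le h

/-- Every `φ`-type is approximately realised on finite sets of parameters. -/
theorem PhiType.exists_approx_fin (hF : F.Full) {σ τ : L.Srt} {φ : Formula L F ![σ, τ]}
    {M : Structure L} (p : PhiType φ M) {k : ℕ} (b : Fin k → M.carrier τ) {η : ℝ} (hη : 0 < η) :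
    ∃ c : M.carrier σ, ∀ i, dist (φ.val₂ M c (b i)) (p.val (b i)) < η := by
  obtain rfl | hk := Nat.eq_zero_or_pos k
  · exact ⟨Classical.arbitrary _, fun i => i.elim0⟩
  obtain ⟨N, e, a, hp⟩ := p.exists_realization
  let Γ : Fin k → L.Srt := fun _ => τ
  let ψ : Fin k → Formula L F (Matrix.vecCons σ Γ) := fun i =>
    φ.subst₂ (Term.var (Γ := Matrix.vecCons σ Γ) 0) (Term.var (Γ := Matrix.vecCons σ Γ) i.succ)
  have hψ : ∀ (K : Structure L) (x : K.carrier σ) (y : K.Tuple Γ),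
      (fun i => (ψ i).realize K (K.cons x y)) = fun i => φ.val₂ K x (y i) := fun K x y =>
    funext fun i => Formula.realize_subst₂ _ _ _ _ _
  obtain ⟨χ, hχ⟩ := hF.exists_formula hk (distConn fun i => p.val (b i))
    (by positivity : 0 < η / 4) ψ
  -- The distance from the tuple `φ(x,b_i)` to its prescribed values is approximately a formula. Its
  -- infimum over `x` is nearly `0` in the extension, because of the realisation `a`, hence also in
  -- `M` by elementarity.
  have hN : ((Formula.inf σ χ).realize N (fun i => e.toFun _ (b i)) : ℝ) < η / 2 := by
    have h1 : (Formula.inf σ χ).realize N (fun i => e.toFun _ (b i)) ≤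
      χ.realize N (N.cons a fun i => e.toFun _ (b i)) := iInf_le _ a
    have h2 := hχ N (N.cons a fun i => e.toFun _ (b i))
    rw [hψ N a (fun i => e.toFun _ (b i))] at h2
    have h3 : ((distConn fun i => p.val (b i)) (fun i => φ.val₂ N a (e.toFun τ (b i))) : ℝ)
        = 0 := by
      show dist (fun i => φ.val₂ N a (e.toFun τ (b i))) (fun i => p.val (b i)) = 0
      rw [dist_eq_zero]
      exact funext fun i => (hp _).symm
    rw [h3, sub_zero, abs_lt] at h2
    have h4 : ((Formula.inf σ χ).realize N (fun i => e.toFun _ (b i)) : ℝ) ≤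
      χ.realize N (N.cons a fun i => e.toFun _ (b i)) := h1
    linarith [h2.2]
  rw [e.map_formula (Γ := Γ) (Formula.inf σ χ) b] at hN
  by_contra! hc
  have hle : η / 2 ≤ ((Formula.inf σ χ).realize M b : ℝ) := by
    have hη1 : η / 2 ≤ 1 := by
      obtain ⟨i, hi⟩ := hc (Classical.arbitrary _)
      linarith [dist_unitInterval_le_one (φ.val₂ M (Classical.arbitrary _) (b i)) (p.val (b i))]
    have : (⟨η / 2, by positivity, hη1⟩ : unitInterval) ≤ (Formula.inf σ χ).realize M b := by
      refine le_iInf fun c => ?_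
      rw [← Subtype.coe_le_coe]
      show η / 2 ≤ _
      have h2 := hχ M (M.cons c b)
      rw [hψ M c b] at h2
      obtain ⟨i, hi⟩ := hc c
      have h3 : η ≤ ((distConn fun i => p.val (b i)) (fun i => φ.val₂ M c (b i)) : ℝ) :=
        hi.trans (dist_le_pi_dist (fun i => φ.val₂ M c (b i)) (fun i => p.val (b i)) i)
      rw [abs_lt] at h2
      linarith [h2.1]
    exact this
  linarith

/-- Approximating `p` on a finite set is an open condition on `c`, so an approximate realisation can
be moved into `D`. -/
theorem PhiType.exists_approx (hF : F.Full) {σ τ : L.Srt} {φ : Formula L F ![σ, τ]}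
    {M : Structure L} (p : PhiType φ M) {D : Set (M.carrier σ)} (hD : Dense D)
    (B : Finset (M.carrier τ)) {η : ℝ} (hη : 0 < η) :
    ∃ c ∈ D, ∀ b ∈ B, dist (φ.val₂ M c b) (p.val b) < η := by
  obtain ⟨c, hc⟩ := p.exists_approx_fin hF (fun i => (B.equivFin.symm i : M.carrier τ)) hη
  have hopen : IsOpen {c : M.carrier σ | ∀ b ∈ B, dist (φ.val₂ M c b) (p.val b) < η} := by
    simp only [Set.ofPred_forall]
    exact isOpen_biInter_finset fun b _ =>
      isOpen_lt ((φ.continuous_val₂_left M b).dist continuous_const) continuous_const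
  obtain ⟨c', hc'D, hc'⟩ := hD.exists_mem_open hopen ⟨c, fun b hb => by
    simpa using hc (B.equivFin ⟨b, hb⟩)⟩
  exact ⟨c', hc'D, hc'⟩

/-! ### Ramsey's theorem -/

/-- Ramsey's theorem for pairs, with colours in a compact metric space. -/
theorem exists_strictMono_dist_lt {X : Type*} [PseudoMetricSpace X] [CompactSpace X]
    (f : ℕ → ℕ → X) {δ : ℝ} (hδ : 0 < δ) :
    ∃ (x : X) (k : ℕ → ℕ), StrictMono k ∧ ∀ i j, i < j → dist (f (k i) (k j)) x < δ := by
  have hU : ∀ g : ℕ → X, ∃ x, Tendsto g (hyperfilter ℕ : Filter ℕ) (𝓝 x) := fun g =>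
    have : Nonempty X := ⟨g 0⟩
    ⟨_, ((hyperfilter ℕ).map g).le_nhds_lim⟩
  -- Iterated limits along a nonprincipal ultrafilter: `y i` is the limit of `f i n` in `n`, and `x`
  -- is the limit of the `y i`. The subsequence is then chosen greedily.
  choose y hy using fun i => hU (f i)
  obtain ⟨x, hx⟩ := hU y
  obtain ⟨k, hk₁, hk₂⟩ := exists_seq_of_forall_finset_exists (fun n => dist (y n) x < δ / 2)
    (fun m n => m < n ∧ dist (f m n) (y m) < δ / 2) (by
      intro s _
      have h1 : ∀ᶠ n in (hyperfilter ℕ : Filter ℕ), dist (y n) x < δ / 2 :=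
        hx (Metric.ball_mem_nhds x (half_pos hδ))
      have h2 : ∀ m ∈ s, ∀ᶠ n in (hyperfilter ℕ : Filter ℕ), m < n ∧
          dist (f m n) (y m) < δ / 2 := fun m _ =>
        Eventually.and (Nat.hyperfilter_le_atTop (eventually_gt_atTop m))
          (hy m (Metric.ball_mem_nhds _ (half_pos hδ)))
      exact (h1.and ((Filter.eventually_all_finset s).2 h2)).exists)
  refine ⟨x, k, strictMono_nat_of_lt_succ fun n => (hk₂ n (n + 1) n.lt_succ_self).1,
    fun i j hij => ?_⟩
  linarith [dist_triangle (f (k i) (k j)) (y (k i)) x, (hk₂ i j hij).2, hk₁ i]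

/-! ### Types over models under stability -/

/-- If `φ` is stable, then every `φ`-type is determined, up to `ε`, by finitely many instances of
`φ` with parameters in a given dense set. -/
theorem Stable.exists_finset (hF : F.Full) {T : Theory L F} {σ τ : L.Srt}
    {φ : Formula L F ![σ, τ]} (hφ : Stable T φ) {M : Structure L} (hM : M.Models T)
    (p : PhiType φ M) {D : Set (M.carrier σ)} (hD : Dense D) {ε : ℝ} (hε : 0 < ε) :
    ∃ C : Finset (M.carrier σ), (C : Set (M.carrier σ)) ⊆ D ∧ ∀ b b' : M.carrier τ,
      (∀ c ∈ C, dist (φ.val₂ M c b) (φ.val₂ M c b') < ε / 6) →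
        dist (p.val b) (p.val b') < ε := by
  classical
  by_contra! hcon
  obtain ⟨f, hf₁, hf₂⟩ := exists_seq_of_forall_finset_exists
    (α := M.carrier σ × M.carrier τ × M.carrier τ)
    (fun t => t.1 ∈ D ∧ ε ≤ dist (p.val t.2.1) (p.val t.2.2))
    (fun t t' => dist (φ.val₂ M t.1 t'.2.1) (φ.val₂ M t.1 t'.2.2) < ε / 6 ∧
      dist (φ.val₂ M t'.1 t.2.1) (p.val t.2.1) < ε / 6 ∧
      dist (φ.val₂ M t'.1 t.2.2) (p.val t.2.2) < ε / 6) (by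
    intro s hs
    obtain ⟨b, b', h1, h2⟩ := hcon (s.image Prod.fst) (by
      intro c hc
      simp only [Finset.coe_image, Set.mem_image, Finset.mem_coe] at hc
      obtain ⟨t, ht, rfl⟩ := hc
      exact (hs t ht).1)
    obtain ⟨c, hcD, hc⟩ := p.exists_approx hF hD
      (s.image (fun t => t.2.1) ∪ s.image (fun t => t.2.2)) (by positivity : 0 < ε / 6)
    refine ⟨(c, b, b'), ⟨hcD, h2⟩, fun t ht => ⟨h1 _ (Finset.mem_image_of_mem _ ht), ?_, ?_⟩⟩
    · exact hc _ (Finset.mem_union_left _ (Finset.mem_image_of_mem _ ht))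
    · exact hc _ (Finset.mem_union_right _ (Finset.mem_image_of_mem (fun t => t.2.2) ht)))
  -- If both gaps were below `ε / 4`, the triangle inequality would bound the gap of `p` strictly by
  -- `2(ε/6) + (ε/4 + ε/6 + ε/4) = ε`.
  have hpair : ∀ i j, i < j →
      ε / 4 ≤ dist (φ.val₂ M (f i).1 (f j).2.1) (φ.val₂ M (f j).1 (f i).2.1) ∨
      ε / 4 ≤ dist (φ.val₂ M (f i).1 (f j).2.2) (φ.val₂ M (f j).1 (f i).2.2) := by
    intro i j hij
    by_contra! h
    obtain ⟨h1, h2, h3⟩ := hf₂ i j hij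
    have h4 := (hf₁ i).2
    have := dist_triangle4 (p.val (f i).2.1) (φ.val₂ M (f j).1 (f i).2.1)
      (φ.val₂ M (f j).1 (f i).2.2) (p.val (f i).2.2)
    have := dist_triangle4 (φ.val₂ M (f j).1 (f i).2.1) (φ.val₂ M (f i).1 (f j).2.1)
      (φ.val₂ M (f i).1 (f j).2.2) (φ.val₂ M (f j).1 (f i).2.2)
    rw [dist_comm] at h2
    have h5 := h.1
    rw [dist_comm] at h5
    linarith [h.2]
  -- The two alternatives are coloured `0` and `1`; two colours within `1/2` of a common point
  -- coincide, so the colouring is constant along `k`.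
  obtain ⟨x, k, hk, hx⟩ := exists_strictMono_dist_lt (X := unitInterval) (fun i j =>
    if ε / 4 ≤ dist (φ.val₂ M (f i).1 (f j).2.1) (φ.val₂ M (f j).1 (f i).2.1) then 0 else 1)
    (δ := 1 / 2) (by norm_num)
  by_cases h01 : ε / 4 ≤ dist (φ.val₂ M (f (k 0)).1 (f (k 1)).2.1)
      (φ.val₂ M (f (k 1)).1 (f (k 0)).2.1)
  · refine hφ (ε / 4) (by positivity) M hM
      ⟨fun i => (f (k i)).1, fun i => (f (k i)).2.1, fun i j hij => ?_⟩
    rw [← Real.dist_eq, ← Subtype.dist_eq]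
    by_contra hne
    have e1 := hx 0 1 zero_lt_one
    have e2 := hx i j hij
    simp only [if_pos h01, if_neg hne] at e1 e2
    have := dist_triangle_left (0 : unitInterval) 1 x
    rw [dist_comm] at e1 e2
    have h1 : dist (0 : unitInterval) 1 = 1 := by simp [Subtype.dist_eq]
    rw [dist_comm x 0, dist_comm x 1] at *
    linarith
  · refine hφ (ε / 4) (by positivity) M hM
      ⟨fun i => (f (k i)).1, fun i => (f (k i)).2.2, fun i j hij => ?_⟩
    rw [← Real.dist_eq, ← Subtype.dist_eq]
    refine (hpair (k i) (k j) (hk hij)).resolve_left fun hne => ?_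
    have e1 := hx 0 1 zero_lt_one
    have e2 := hx i j hij
    simp only [if_neg h01, if_pos hne] at e1 e2
    have := dist_triangle_left (0 : unitInterval) 1 x
    have h1 : dist (0 : unitInterval) 1 = 1 := by simp [Subtype.dist_eq]
    rw [dist_comm x 0, dist_comm x 1] at *
    linarith

/-- A function that varies by less than `ε` whenever the points `Φ b` of the cube are `δ`-close is,
up to `ε`, a continuous function of `Φ b`. -/
theorem exists_continuousMap_dist_le {k : ℕ} {B : Type*} [Nonempty B]
    (Φ : B → Fin k → unitInterval) (f : B → unitInterval) {ε δ : ℝ} (hδ : 0 < δ)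
    (h : ∀ b b', dist (Φ b) (Φ b') < δ → dist (f b) (f b') < ε) :
    ∃ g : C(Fin k → unitInterval, unitInterval), ∀ b, dist (g (Φ b)) (f b) ≤ ε := by
  -- McShane-type extension. With slope `δ⁻¹`, an index `b'` whose point is at distance at least `δ`
  -- contributes at least `1`, so only `δ`-close points can bring the infimum below `f b`.
  let G : (Fin k → unitInterval) → ℝ := fun t => ⨅ b, ((f b : ℝ) + δ⁻¹ * dist t (Φ b))
  have hpos : ∀ t b, 0 ≤ (f b : ℝ) + δ⁻¹ * dist t (Φ b) := fun t b =>
    add_nonneg (f b).2.1 (by positivity)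
  have hbdd : ∀ t, BddBelow (range fun b => (f b : ℝ) + δ⁻¹ * dist t (Φ b)) := fun t =>
    ⟨0, by rintro _ ⟨b, rfl⟩; exact hpos t b⟩
  have hG : LipschitzWith ⟨δ⁻¹, (inv_pos.2 hδ).le⟩ G := by
    refine LipschitzWith.of_le_add_mul _ fun t t' => ?_
    rw [← sub_le_iff_le_add]
    refine le_ciInf fun b => ?_
    rw [sub_le_iff_le_add]
    refine (ciInf_le (hbdd t) b).trans ?_
    have h1 := mul_le_mul_of_nonneg_left (dist_triangle t t' (Φ b)) (inv_pos.2 hδ).le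
    show (f b : ℝ) + δ⁻¹ * dist t (Φ b) ≤ f b + δ⁻¹ * dist t' (Φ b) + δ⁻¹ * dist t t'
    linarith
  refine ⟨⟨fun t => ⟨min 1 (G t), le_min zero_le_one (le_ciInf (hpos t)), min_le_left _ _⟩, ?_⟩,
    fun b => ?_⟩
  · exact (continuous_const.min hG.continuous).subtype_mk _
  · have h1 : G (Φ b) ≤ f b := (ciInf_le (hbdd _) b).trans (by simp)
    have hε : 0 < ε := dist_nonneg.trans_lt (h b b (by simpa using hδ))
    have h2 : (f b : ℝ) - ε ≤ G (Φ b) := by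
      refine le_ciInf fun b' => ?_
      by_cases hb : dist (Φ b) (Φ b') < δ
      · have h3 := h b b' hb
        rw [Subtype.dist_eq, Real.dist_eq, abs_lt] at h3
        have : 0 ≤ δ⁻¹ * dist (Φ b) (Φ b') := by positivity
        linarith
      · have h3 := mul_le_mul_of_nonneg_left (not_lt.1 hb) (inv_pos.2 hδ).le
        rw [inv_mul_cancel₀ hδ.ne'] at h3
        linarith [(f b).2.2, (f b').2.1]
    rw [Subtype.dist_eq, Real.dist_eq, abs_le]
    show -ε ≤ min 1 (G (Φ b)) - f b ∧ min 1 (G (Φ b)) - f b ≤ ε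
    rw [min_eq_right (h1.trans (f b).2.2)]
    constructor <;> linarith

/-- Combines the finite determination of `p` with the extension to a continuous function on the
cube. Both the bounds on types and their definability rest on this form. -/
theorem Stable.exists_conn (hF : F.Full) {T : Theory L F} {σ τ : L.Srt}
    {φ : Formula L F ![σ, τ]} (hφ : Stable T φ) {M : Structure L} (hM : M.Models T)
    (p : PhiType φ M) {D : Set (M.carrier σ)} (hD : Dense D) {ε : ℝ} (hε : 0 < ε) :
    ∃ (k : ℕ) (c : Fin (k + 1) → D) (g : C(Fin (k + 1) → unitInterval, unitInterval)),
      ∀ b, dist (g fun i => φ.val₂ M (c i) b) (p.val b) ≤ ε := by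
  obtain ⟨C, hCD, hC⟩ := hφ.exists_finset hF hM p hD hε
  -- A dummy parameter keeps the arity positive even if `C` is empty, since fullness concerns
  -- positive arities only.
  obtain ⟨c₀, hc₀⟩ := hD.nonempty
  let c : Fin (C.card + 1) → D :=
    Fin.cons ⟨c₀, hc₀⟩ fun i => ⟨C.equivFin.symm i, hCD (C.equivFin.symm i).2⟩
  obtain ⟨g, hg⟩ := exists_continuousMap_dist_le (fun b i => φ.val₂ M (c i) b) p.val
    (ε := ε) (δ := ε / 6) (by positivity) (fun b b' hbb' => hC b b' fun x hx => by
      have := (dist_le_pi_dist (fun i => φ.val₂ M (c i) b) (fun i => φ.val₂ M (c i) b')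
        (C.equivFin ⟨x, hx⟩).succ).trans_lt hbb'
      simpa [c] using this)
  exact ⟨C.card, c, g, hg⟩

/-! ### Forced limits -/

/-- Consecutive terms differ by at most `2⁻ⁿ⁻² + 2⁻ⁿ⁻³`, which is below `2⁻ⁿ⁻¹`, so the truncation
never acts. -/
theorem forcedLim_eq {a : ℕ → ℝ} {l : ℝ} (h : ∀ n, |a n - l| ≤ (1 / 2) ^ (n + 2)) :
    forcedLim a = l := by
  have hseq : forcedSeq a = a := by
    funext n
    induction n with
    | zero => rfl
    | succ n ih =>
      have h1 := abs_le.1 (h n)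
      have h2 := abs_le.1 (h (n + 1))
      have h3 : (0 : ℝ) < (1 / 2) ^ n := by positivity
      simp only [pow_succ] at h1 h2
      rw [forcedSeq, ih, min_eq_right, max_eq_right] <;> simp only [pow_succ] <;> linarith
  have h0 : Tendsto a atTop (𝓝 l) := by
    rw [tendsto_iff_dist_tendsto_zero]
    refine squeeze_zero (fun _ => dist_nonneg) (g := fun n : ℕ => ((1 : ℝ) / 2) ^ (n + 2))
      (fun n => by rw [Real.dist_eq]; exact h n) ?_
    exact (tendsto_add_atTop_iff_nat 2).2
      (tendsto_pow_atTop_nhds_zero_of_lt_one (by norm_num) (by norm_num))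
  have h1 := tendsto_forcedSeq a
  rw [hseq] at h1
  exact tendsto_nhds_unique h1 h0

theorem dist_forcedSeq_succ_le (a : ℕ → ℝ) (n : ℕ) :
    dist (forcedSeq a n) (forcedSeq a (n + 1)) ≤ 1 / 2 / 2 ^ n := by
  have h : (0 : ℝ) < (1 / 2) ^ (n + 1) := by positivity
  have h2 : (1 : ℝ) / 2 / 2 ^ n = (1 / 2) ^ (n + 1) := by rw [pow_succ, one_div_pow]; ring
  rw [dist_comm, Real.dist_eq, h2, abs_le, forcedSeq]
  constructor
  · linarith [le_max_left (forcedSeq a n - (1 / 2) ^ (n + 1))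
      (min (forcedSeq a n + (1 / 2) ^ (n + 1)) (a (n + 1)))]
  · rw [sub_le_iff_le_add, max_le_iff]
    constructor
    · linarith
    · exact (min_le_left _ _).trans (by linarith)

theorem dist_forcedSeq_forcedLim_le (a : ℕ → ℝ) (n : ℕ) :
    dist (forcedSeq a n) (forcedLim a) ≤ 1 / 2 ^ n :=
  dist_le_of_le_geometric_two_of_tendsto (C := 1) (dist_forcedSeq_succ_le a)
    (tendsto_forcedSeq a) n

/-- Each truncation is built from `max` and `min`, which do not expand the sup distance; the `n`-th
term also involves only the first `n + 1` entries. -/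
theorem abs_forcedSeq_sub_le {a a' : ℕ → ℝ} {η : ℝ} {n : ℕ} (h : ∀ i ≤ n, |a i - a' i| ≤ η) :
    |forcedSeq a n - forcedSeq a' n| ≤ η := by
  induction n with
  | zero => exact h 0 le_rfl
  | succ n ih =>
    have h1 := ih fun i hi => h i (hi.trans n.le_succ)
    have h2 := h (n + 1) le_rfl
    simp only [forcedSeq]
    refine (abs_max_sub_max_le_max _ _ _ _).trans (max_le (by simpa using h1) ?_)
    exact (abs_min_sub_min_le_max _ _ _ _).trans (max_le (by simpa using h1) h2)

/-! ### Definability of types under stability -/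

theorem Stable.isDefinable (hF : F.Full) {T : Theory L F} {σ τ : L.Srt}
    {φ : Formula L F ![σ, τ]} (hφ : Stable T φ) {M : Structure L} (hM : M.Models T)
    (p : PhiType φ M) : p.IsDefinable := by
  have key : ∀ n : ℕ, ∃ ψ : ParamFormula F M τ, ∀ b,
      |(ψ.eval b : ℝ) - p.val b| ≤ (1 / 2) ^ (n + 2) := by
    intro n
    -- Half of the tolerance `2⁻ⁿ⁻²` goes to the continuous connective, half to its approximation by
    -- a formula.
    have hε : (0 : ℝ) < (1 / 2) ^ (n + 3) := by positivity
    obtain ⟨k, c, g, hg⟩ := hφ.exists_conn hF hM p dense_univ hε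
    let Γ : Fin (k + 1) → L.Srt := fun _ => σ
    obtain ⟨χ, hχ⟩ := hF.exists_formula k.succ_pos g hε (fun i : Fin (k + 1) =>
      φ.subst₂ (Term.var (Γ := Matrix.vecCons τ Γ) i.succ) (Term.var (Γ := Matrix.vecCons τ Γ) 0))
    refine ⟨⟨k + 1, Γ, χ, fun i => c i⟩, fun b => ?_⟩
    have h1 := hχ M (M.cons b fun i => c i)
    have h2 : (fun i => (φ.subst₂ (Term.var (Γ := Matrix.vecCons τ Γ) i.succ)
        (Term.var (Γ := Matrix.vecCons τ Γ) 0)).realize M (M.cons b fun i => c i)) =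
        fun i => φ.val₂ M (c i) b := funext fun i => Formula.realize_subst₂ _ _ _ _ _
    rw [h2] at h1
    have h3 := hg b
    rw [Subtype.dist_eq, Real.dist_eq] at h3
    have h4 := abs_sub_le (χ.realize M (M.cons b fun i => c i) : ℝ)
      (g fun i => φ.val₂ M (c i) b) (p.val b)
    have h5 : ((1 : ℝ) / 2) ^ (n + 2) = (1 / 2) ^ (n + 3) + (1 / 2) ^ (n + 3) := by ring
    show |(χ.realize M (M.cons b fun i => c i) : ℝ) - p.val b| ≤ _
    linarith
  choose ψ hψ using key
  exact ⟨ψ, fun b => (forcedLim_eq fun n => hψ n b).symm⟩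

/-! ### Density characters -/

theorem exists_dense_mk_eq (X : Type u) [TopologicalSpace X] :
    ∃ D : Set X, Dense D ∧ Cardinal.mk D = density X :=
  csInf_mem (s := {κ | ∃ D : Set X, Dense D ∧ Cardinal.mk D = κ}) ⟨_, univ, dense_univ, rfl⟩

theorem density_le_mk {X : Type u} [TopologicalSpace X] {D : Set X} (hD : Dense D) :
    density X ≤ Cardinal.mk D :=
  csInf_le' ⟨D, hD, rfl⟩

theorem mk_sigma_nat_le {κ : Cardinal.{u}} (hκ : Cardinal.aleph0 ≤ κ) {X : ℕ → Type u}
    (h : ∀ n, Cardinal.mk (X n) ≤ κ) : Cardinal.mk (Σ n, X n) ≤ κ := by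
  rw [Cardinal.mk_sigma]
  refine (Cardinal.sum_le_sum _ (fun _ => κ) h).trans ?_
  rw [Cardinal.sum_const]
  simpa using Cardinal.mul_le_of_le hκ hκ le_rfl

theorem mk_sigma_le {κ : Cardinal.{u}} (hκ : Cardinal.aleph0 ≤ κ) {ι : Type u} {X : ι → Type u}
    (hι : Cardinal.mk ι ≤ κ) (h : ∀ i, Cardinal.mk (X i) ≤ κ) : Cardinal.mk (Σ i, X i) ≤ κ := by
  rw [Cardinal.mk_sigma]
  refine (Cardinal.sum_le_sum _ (fun _ => κ) h).trans ?_
  rw [Cardinal.sum_const']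
  exact Cardinal.mul_le_of_le hκ hι le_rfl

theorem mk_prod_nat_le {κ : Cardinal.{u}} (hκ : Cardinal.aleph0 ≤ κ) {X : Type u}
    (hX : Cardinal.mk X ≤ κ) : Cardinal.mk (X × ℕ) ≤ κ := by
  rw [Cardinal.mk_prod]
  simpa using Cardinal.mul_le_of_le hκ hX hκ

theorem mk_pi_fin_le {κ : Cardinal.{u}} (hκ : Cardinal.aleph0 ≤ κ) {n : ℕ} {X : Fin n → Type u}
    (h : ∀ i, Cardinal.mk (X i) ≤ κ) : Cardinal.mk (∀ i, X i) ≤ κ := by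
  rw [Cardinal.mk_pi]
  refine (Cardinal.prod_le_prod _ (fun _ => κ) h).trans ?_
  rw [Cardinal.prod_const]
  simpa using Cardinal.power_nat_le hκ

theorem mk_iUnion_nat_le {κ : Cardinal.{u}} (hκ : Cardinal.aleph0 ≤ κ) {X : Type u}
    {D : ℕ → Set X} (h : ∀ n, Cardinal.mk (D n) ≤ κ) : Cardinal.mk (⋃ n, D n) ≤ κ := by
  refine le_trans ?_ (mk_sigma_nat_le hκ h)
  refine Cardinal.mk_le_of_surjective (f := fun x : Σ n, D n =>
    (⟨x.2, mem_iUnion.2 ⟨x.1, x.2.2⟩⟩ : ⋃ n, D n)) ?_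
  rintro ⟨x, hx⟩
  obtain ⟨n, hn⟩ := mem_iUnion.1 hx
  exact ⟨⟨n, x, hn⟩, rfl⟩

/-- A space whose points are determined up to `ε` by an element of `I`, for every `ε > 0`, has
density character at most `#I`. -/
theorem density_le_of_code {X I : Type u} [PseudoMetricSpace X]
    (hI : Cardinal.aleph0 ≤ Cardinal.mk I)
    (h : ∀ ε : ℝ, 0 < ε → ∃ f : X → I, ∀ x y, f x = f y → dist x y ≤ ε) :
    density X ≤ Cardinal.mk I := by
  choose f hf using fun n : ℕ => h (1 / (n + 1)) (by positivity)
  let D : ℕ → Set X := fun n => range fun i : range (f n) => i.2.choose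
  have hD : Dense (⋃ n, D n) := by
    rw [Metric.dense_iff]
    intro x r hr
    obtain ⟨n, hn⟩ := exists_nat_one_div_lt hr
    let i : range (f n) := ⟨f n x, x, rfl⟩
    refine ⟨i.2.choose, ?_, mem_iUnion.2 ⟨n, i, rfl⟩⟩
    exact (hf n _ _ i.2.choose_spec).trans_lt hn
  refine (density_le_mk hD).trans ?_
  exact mk_iUnion_nat_le hI fun n => Cardinal.mk_range_le.trans (Cardinal.mk_set_le _)

/-- A finite dense set in a T₁ space is closed, hence is the whole space. -/
theorem mk_eq_density_of_lt_aleph0 {X : Type u} [TopologicalSpace X] [T1Space X]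
    (h : density X < Cardinal.aleph0) : Cardinal.mk X = density X := by
  obtain ⟨D, hD, hc⟩ := exists_dense_mk_eq X
  have hfin : D.Finite := Cardinal.lt_aleph0_iff_set_finite.1 (hc ▸ h)
  have : D = univ := by rw [← hfin.isClosed.closure_eq, hD.closure_eq]
  rw [← hc, this, Cardinal.mk_univ]

/-- A space containing an `ε`-separated family has density character at least the size of the
family. -/
theorem mk_le_density_of_separated {X A : Type u} [PseudoMetricSpace X] {ε : ℝ} (hε : 0 < ε)
    (f : A → X) (hf : ∀ a b, a ≠ b → ε ≤ dist (f a) (f b)) : Cardinal.mk A ≤ density X := by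
  obtain ⟨D, hD, hc⟩ := exists_dense_mk_eq X
  rw [← hc]
  choose g hgD hg using fun a => hD.exists_dist_lt (f a) (half_pos hε)
  refine Cardinal.mk_le_of_injective (f := fun a => (⟨g a, hgD a⟩ : D)) fun a b hab => ?_
  by_contra hne
  have h1 : g a = g b := congrArg Subtype.val hab
  have h2 := hg b
  rw [← h1] at h2
  linarith [hf a b hne, dist_triangle_right (f a) (f b) (g a), hg a]

theorem Structure.density_carrier_le (M : Structure L) (s : L.Srt) :
    ContLogic.density (M.carrier s) ≤ M.density :=
  Cardinal.le_sum (fun s => ContLogic.density (M.carrier s)) s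

/-- If `φ` is stable, the density character of the space of `φ`-types is bounded by that of the
structure. -/
theorem Stable.density_phiType_le (hF : F.Full) {T : Theory L F} {σ τ : L.Srt}
    {φ : Formula L F ![σ, τ]} (hφ : Stable T φ) {M : Structure L} (hM : M.Models T) :
    ContLogic.density (PhiType φ M) ≤ M.density := by
  refine le_trans ?_ (M.density_carrier_le σ)
  -- A finite density character leaves no room for countably many codes. Over a finite sort of `x`,
  -- however, every `φ`-type is realised: otherwise each `c` fails at some `b c`, and an
  -- approximation on these finitely many parameters, closer than the least failure, is impossible.
  obtain hfin | hinf := lt_or_ge (ContLogic.density (M.carrier σ)) Cardinal.aleph0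
  · rw [← mk_eq_density_of_lt_aleph0 hfin]
    refine (density_le_mk dense_univ).trans ?_
    rw [Cardinal.mk_univ]
    have : Finite (M.carrier σ) := Cardinal.lt_aleph0_iff_finite.1
      ((mk_eq_density_of_lt_aleph0 hfin).trans_lt hfin)
    have key : ∀ p : PhiType φ M, ∃ c, ∀ b, φ.val₂ M c b = p.val b := by
      classical
      have := Fintype.ofFinite (M.carrier σ)
      intro p
      by_contra! h
      choose b hb using h
      obtain ⟨c₀, -, hc₀⟩ := Finset.exists_min_image Finset.univ
        (fun c => dist (φ.val₂ M c (b c)) (p.val (b c))) Finset.univ_nonempty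
      obtain ⟨c, -, hc⟩ := p.exists_approx hF dense_univ (Finset.univ.image b)
        (dist_pos.2 (hb c₀))
      exact (hc (b c) (by simp)).not_ge (hc₀ c (Finset.mem_univ c))
    choose f hf using key
    refine Cardinal.mk_le_of_injective (f := f) fun p q hpq => PhiType.val_injective ?_
    funext b
    rw [← hf p, ← hf q, hpq]
  · obtain ⟨D, hD, hDc⟩ := exists_dense_mk_eq (M.carrier σ)
    rw [← hDc] at hinf ⊢
    -- A code is a tuple from the dense set `D` together with an index into a dense sequence of
    -- connectives of that arity.
    have hI : Cardinal.mk (Σ k : ℕ, (Fin (k + 1) → D) × ℕ) ≤ Cardinal.mk D :=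
      mk_sigma_nat_le hinf fun k => mk_prod_nat_le hinf (mk_pi_fin_le hinf fun _ => le_rfl)
    have hI' : Cardinal.mk D ≤ Cardinal.mk (Σ k : ℕ, (Fin (k + 1) → D) × ℕ) :=
      Cardinal.mk_le_of_injective (f := fun d => ⟨0, fun _ => d, 0⟩) fun d d' h => by
        simpa [funext_iff] using h
    refine (density_le_of_code (hinf.trans hI') fun ε hε => ?_).trans hI
    choose k c g hg using fun p : PhiType φ M =>
      hφ.exists_conn hF hM p hD (by positivity : 0 < ε / 4)
    choose n hn using fun p => (TopologicalSpace.denseRange_denseSeq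
      C(Fin (k p + 1) → unitInterval, unitInterval)).exists_dist_lt (g p)
      (by positivity : 0 < ε / 4)
    have hp : ∀ p b, dist (TopologicalSpace.denseSeq
        C(Fin (k p + 1) → unitInterval, unitInterval) (n p) fun i => φ.val₂ M (c p i) b)
        (p.val b) ≤ ε / 2 := fun p b => by
      have h1 := (ContinuousMap.dist_apply_le_dist (fun i => φ.val₂ M (c p i) b)).trans_lt (hn p)
      have h2 := hg p b
      have h3 := dist_triangle_left (TopologicalSpace.denseSeq
        C(Fin (k p + 1) → unitInterval, unitInterval) (n p) fun i => φ.val₂ M (c p i) b)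
        (p.val b) (g p fun i => φ.val₂ M (c p i) b)
      linarith
    let val : (Σ k : ℕ, (Fin (k + 1) → D) × ℕ) → M.carrier τ → unitInterval := fun x b =>
      TopologicalSpace.denseSeq C(Fin (x.1 + 1) → unitInterval, unitInterval) x.2.2
        fun i => φ.val₂ M (x.2.1 i) b
    refine ⟨fun p => ⟨k p, c p, n p⟩, fun p q hpq => PhiType.dist_le fun b => ?_⟩
    have h1 : dist (val ⟨k p, c p, n p⟩ b) (p.val b) ≤ ε / 2 := hp p b
    have h2 : dist (val ⟨k q, c q, n q⟩ b) (q.val b) ≤ ε / 2 := hp q b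
    simp only at hpq
    rw [← hpq] at h2
    linarith [dist_triangle_left (p.val b) (q.val b) (val ⟨k p, c p, n p⟩ b)]

/-! ### Counting definable types -/

theorem aleph0_le_langCard (F : Connectives) (s : L.Srt) : Cardinal.aleph0 ≤ langCard L F := by
  have h := Cardinal.mk_le_of_injective (α := ULift.{u} ℕ)
    (β := Σ n : ℕ, Σ Γ : Fin n → L.Srt, Formula L F Γ)
    (f := fun n => ⟨n.down + 1, fun _ => s,
      .dist (Term.var (Γ := fun _ : Fin (n.down + 1) => s) 0)
        (Term.var (Γ := fun _ : Fin (n.down + 1) => s) 0)⟩) (by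
      rintro ⟨m⟩ ⟨n⟩ h
      have := (Sigma.mk.inj_iff.1 h).1
      simp only [add_left_inj] at this
      rw [this])
  simpa [langCard] using h

/-- Formulae in a variable of sort `s` with parameters in the sets `D`. -/
abbrev ParamCode (F : Connectives) (M : Structure L) (D : ∀ s, Set (M.carrier s)) (s : L.Srt) :
    Type u :=
  Σ n : ℕ, Σ Γ : Fin n → L.Srt, Formula L F (Matrix.vecCons s Γ) × ∀ i, D (Γ i)

/-- A code is recovered from its formula, viewed in a context one variable longer, and its
parameters. This is why the auxiliary sigma type shifts the indices by one. -/
theorem mk_paramCode_le {M : Structure L} {D : ∀ s, Set (M.carrier s)} {s : L.Srt}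
    {κ : Cardinal.{u}} (hκ : langCard L F ≤ κ) (hD : ∀ s, Cardinal.mk (D s) ≤ κ) :
    Cardinal.mk (ParamCode F M D s) ≤ κ := by
  have h0 := (aleph0_le_langCard F s).trans hκ
  have h1 : Cardinal.mk (Σ x : (Σ n : ℕ, Σ Γ : Fin n → L.Srt, Formula L F Γ),
      ∀ i : Fin (x.1 - 1), D (x.2.1 ⟨i + 1, by omega⟩)) ≤ κ :=
    mk_sigma_le h0 hκ fun x => mk_pi_fin_le h0 fun i => hD _
  refine le_trans (Cardinal.mk_le_of_injective (f := fun x : ParamCode F M D s =>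
    ⟨⟨x.1 + 1, Matrix.vecCons s x.2.1, x.2.2.1⟩, x.2.2.2⟩) ?_) h1
  rintro ⟨n, Γ, ψ, v⟩ ⟨n', Γ', ψ', v'⟩ h
  obtain ⟨h2, h3⟩ := Sigma.mk.inj_iff.1 h
  obtain ⟨h4, h5⟩ := Sigma.mk.inj_iff.1 h2
  obtain rfl : n = n' := Nat.succ_injective h4
  obtain ⟨h6, h7⟩ := Sigma.mk.inj_iff.1 (eq_of_heq h5)
  obtain rfl : Γ = Γ' := by
    funext i
    exact congrFun h6 i.succ
  obtain rfl := eq_of_heq h7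
  obtain rfl := eq_of_heq h3
  rfl

/-- If all `φ`-types over `M` are definable, their space is not larger than the language and `M`. -/
theorem density_phiType_le_of_isDefinable {σ τ : L.Srt} {φ : Formula L F ![σ, τ]}
    {M : Structure L} (h : ∀ p : PhiType φ M, p.IsDefinable) {κ : Cardinal.{u}}
    (hκ : langCard L F ≤ κ) (hM : M.density ≤ κ) : ContLogic.density (PhiType φ M) ≤ κ := by
  have h0 := (aleph0_le_langCard F σ).trans hκ
  choose D hD hDc using fun s => exists_dense_mk_eq (M.carrier s)
  -- The summand `κ.out` pads the set of codes to cardinality exactly `κ`, so that it is infinite.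
  have hI : Cardinal.mk ((Σ n : ℕ, (Fin (n + 1) → ParamCode F M D τ)) ⊕ κ.out) = κ := by
    rw [Cardinal.mk_sum, Cardinal.lift_id, Cardinal.lift_id, Cardinal.mk_out]
    exact Cardinal.add_eq_right h0 (mk_sigma_nat_le h0 fun n => mk_pi_fin_le h0 fun _ =>
      mk_paramCode_le hκ fun s => (hDc s).trans_le ((M.density_carrier_le s).trans hM))
  have happrox : ∀ (θ : ParamFormula F M τ) (ε : ℝ), 0 < ε → ∃ x : ParamCode F M D τ, ∀ b,
      |(θ.eval b : ℝ) - x.2.2.1.realize M (M.cons b fun i => x.2.2.2 i)| ≤ ε := by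
    rintro ⟨n, Γ, ψ, v⟩ ε hε
    obtain ⟨δ, hδ, hψ⟩ := Metric.uniformContinuous_iff.1 (ψ.uniformContinuous_realize M) ε hε
    choose w hwD hw using fun i => (hD (Γ i)).exists_dist_lt (v i) hδ
    refine ⟨⟨n, Γ, ψ, fun i => ⟨w i, hwD i⟩⟩, fun b => ?_⟩
    rw [← Real.dist_eq]
    exact (hψ ((M.dist_cons_cons b v w).trans_lt ((dist_pi_lt_iff hδ).2 hw))).le
  refine (density_le_of_code (h0.trans hI.ge) fun ε hε => ?_).trans hI.le
  obtain ⟨n, hn⟩ := exists_pow_lt_of_lt_one (by positivity : 0 < ε / 4)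
    (by norm_num : (1 : ℝ) / 2 < 1)
  choose ψ hψ using h
  choose x hx using fun (p : PhiType φ M) (i : ℕ) =>
    happrox (ψ p i) (ε / 4) (by positivity)
  refine ⟨fun p => Sum.inl ⟨n, fun i => x p i⟩, fun p q hpq => PhiType.dist_le fun b => ?_⟩
  have hx' : ∀ i ≤ n, x p i = x q i := fun i hi => by
    have h1 := eq_of_heq (Sigma.mk.inj_iff.1 (Sum.inl_injective hpq)).2
    exact congrFun h1 ⟨i, by omega⟩
  have h1 := abs_forcedSeq_sub_le (a := fun i => ((ψ p i).eval b : ℝ))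
    (a' := fun i => ((ψ q i).eval b : ℝ)) (η := ε / 2) (n := n) fun i hi => by
      have h1 := hx p i b
      have h2 := hx q i b
      rw [← hx' i hi, abs_sub_comm] at h2
      refine (abs_sub_le _ _ _).trans ((add_le_add h1 h2).trans ?_)
      linarith
  rw [← Real.dist_eq] at h1
  have h2 := dist_forcedSeq_forcedLim_le (fun i => ((ψ p i).eval b : ℝ)) n
  have h3 := dist_forcedSeq_forcedLim_le (fun i => ((ψ q i).eval b : ℝ)) n
  rw [← hψ p b] at h2
  rw [← hψ q b] at h3
  rw [Subtype.dist_eq]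
  rw [one_div_pow] at hn
  rw [dist_comm] at h2
  linarith [dist_triangle4 (p.val b : ℝ) (forcedSeq (fun i => ((ψ p i).eval b : ℝ)) n)
    (forcedSeq (fun i => ((ψ q i).eval b : ℝ)) n) (q.val b)]

/-! ### Ultrapowers -/

namespace Ultrapower

variable {ι : Type u} (U : Ultrafilter ι)

/-- The limit of a function along an ultrafilter. -/
noncomputable def ulim {X : Type*} [TopologicalSpace X] [Nonempty X] (g : ι → X) : X :=
  (U.map g).lim

theorem tendsto_ulim {X : Type*} [TopologicalSpace X] [CompactSpace X] [Nonempty X] (g : ι → X) :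
    Tendsto g U (𝓝 (ulim U g)) :=
  (U.map g).le_nhds_lim

/-- The space of families of points of `X`, with the distance given by the limit along `U`. -/
@[nolint unusedArguments]
def Pre (_ : Ultrafilter ι) (X : Type u) : Type u := ι → X

variable (M : Structure L) (s : L.Srt)

/-- The distance of two points of `M`, as an element of `[0,1]`. -/
noncomputable def unitDist {M : Structure L} {s : L.Srt} (a b : M.carrier s) : unitInterval :=
  ⟨dist a b, dist_nonneg, M.dist_le_one s a b⟩

theorem tendsto_dist (x y : ι → M.carrier s) :
    Tendsto (fun i => dist (x i) (y i)) U
      (𝓝 (ulim U fun i => unitDist (x i) (y i) : unitInterval)) :=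
  (continuous_subtype_val.tendsto _).comp (tendsto_ulim U fun i => unitDist (x i) (y i))

noncomputable instance : PseudoMetricSpace (Pre U (M.carrier s)) where
  dist x y := (ulim U fun i => unitDist (x i) (y i) : unitInterval)
  dist_self x := by
    refine tendsto_nhds_unique (tendsto_dist U M s x x) ?_
    simp
  dist_comm x y := by
    refine tendsto_nhds_unique (tendsto_dist U M s x y) ?_
    simpa only [dist_comm] using tendsto_dist U M s y x
  dist_triangle x y z :=
    le_of_tendsto_of_tendsto' (tendsto_dist U M s x z)
      ((tendsto_dist U M s x y).add (tendsto_dist U M s y z)) fun i => dist_triangle _ _ _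

/-- The sorts of the ultrapower. -/
abbrev Carrier : Type u := SeparationQuotient (Pre U (M.carrier s))

variable {M s}

/-- The class of a family in the ultrapower. -/
noncomputable def mk (x : ι → M.carrier s) : Carrier U M s :=
  SeparationQuotient.mk (X := Pre U (M.carrier s)) x

/-- A representative of an element of the ultrapower. -/
noncomputable def rep (x : Carrier U M s) : ι → M.carrier s :=
  Function.surjInv (SeparationQuotient.surjective_mk (X := Pre U (M.carrier s))) x

@[simp] theorem mk_rep (x : Carrier U M s) : mk U (rep U x) = x :=
  Function.surjInv_eq _ x

theorem tendsto_dist_mk (x y : ι → M.carrier s) :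
    Tendsto (fun i => dist (x i) (y i)) U (𝓝 (dist (mk U x) (mk U y))) :=
  tendsto_dist U M s x y

theorem tendsto_dist_rep (x y : Carrier U M s) :
    Tendsto (fun i => dist (rep U x i) (rep U y i)) U (𝓝 (dist x y)) := by
  simpa using tendsto_dist_mk U (rep U x) (rep U y)

theorem tendsto_dist_rep_mk (x : ι → M.carrier s) :
    Tendsto (fun i => dist (rep U (mk U x) i) (x i)) U (𝓝 0) := by
  simpa using tendsto_dist_mk U (rep U (mk U x)) x

/-- Along an ultrafilter that is not countably complete, ultrapowers are complete. -/
theorem completeSpace_carrier (M : Structure L) (s : L.Srt) (h : ι → ℕ) (hU : Tendsto h U atTop) :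
    CompleteSpace (Carrier U M s) := by
  refine Metric.complete_of_convergent_controlled_sequences (fun n => (1 / 2 : ℝ) ^ n)
    (fun n => by positivity) fun u hu => ?_
  classical
  -- Diagonal argument: at coordinate `i`, follow the sequence as far as its steps stay small, but
  -- no further than `h i`. This length tends to infinity along `U` because `h` does.
  let P : ι → ℕ → Prop := fun i m => ∀ k < m, dist (rep U (u k) i) (rep U (u (k + 1)) i)
    < (1 / 2) ^ k
  have hP0 : ∀ i, P i 0 := fun i k hk => absurd hk (Nat.not_lt_zero k)
  let m : ι → ℕ := fun i => Nat.findGreatest (P i) (h i)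
  have hm : ∀ i, P i (m i) := fun i => Nat.findGreatest_spec (Nat.zero_le _) (hP0 i)
  let y : ι → M.carrier s := fun i => rep U (u (m i)) i
  refine ⟨mk U y, ?_⟩
  have hlarge : ∀ n, ∀ᶠ i in U, n ≤ m i := by
    intro n
    have h1 : ∀ᶠ i in U, P i n := by
      have : ∀ k ∈ Finset.range n, ∀ᶠ i in U,
          dist (rep U (u k) i) (rep U (u (k + 1)) i) < (1 / 2) ^ k := fun k _ =>
        (tendsto_dist_rep U _ _).eventually_lt_const (hu k k (k + 1) le_rfl k.le_succ)
      filter_upwards [(Filter.eventually_all_finset _).2 this] with i hi k hk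
      exact hi k (Finset.mem_range.2 hk)
    filter_upwards [h1, hU.eventually_ge_atTop n] with i hi hn
    exact Nat.le_findGreatest hn hi
  have hdist : ∀ n, dist (u n) (mk U y) ≤ 2 * (1 / 2) ^ n := by
    intro n
    have h1 := tendsto_dist_mk U (rep U (u n)) y
    rw [mk_rep] at h1
    refine le_of_tendsto h1 ?_
    filter_upwards [hlarge n] with i hi
    have key : ∀ j, n + j ≤ m i →
        dist (rep U (u n) i) (rep U (u (n + j)) i) ≤ 2 * (1 / 2) ^ n - 2 * (1 / 2) ^ (n + j) := by
      intro j
      induction j with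
      | zero => intro _; simp
      | succ j ih =>
        intro hj
        have h2 := ih (by omega)
        have h3 := hm i (n + j) (by omega)
        have h4 := dist_triangle (rep U (u n) i) (rep U (u (n + j)) i) (rep U (u (n + j + 1)) i)
        have h5 : (1 / 2 : ℝ) ^ (n + j + 1) = (1 / 2) ^ (n + j) / 2 := by rw [pow_succ]; ring
        rw [← add_assoc, h5]
        linarith
    have h2 := key (m i - n) (by omega)
    rw [Nat.add_sub_cancel' hi] at h2
    have : (0 : ℝ) < (1 / 2) ^ (m i) := by positivity
    show dist (rep U (u n) i) (rep U (u (m i)) i) ≤ _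
    linarith
  rw [tendsto_iff_dist_tendsto_zero]
  refine squeeze_zero (fun _ => dist_nonneg) hdist ?_
  simpa using (tendsto_pow_atTop_nhds_zero_of_lt_one (by norm_num : (0 : ℝ) ≤ 1 / 2)
    (by norm_num)).const_mul 2

/-- Uniformly continuous maps preserve closeness along `U`. -/
theorem tendsto_dist_of_uniformContinuous {X Y : Type*} [PseudoMetricSpace X]
    [PseudoMetricSpace Y] {f : X → Y} (hf : UniformContinuous f) {x y : ι → X}
    (h : Tendsto (fun i => dist (x i) (y i)) U (𝓝 0)) :
    Tendsto (fun i => dist (f (x i)) (f (y i))) U (𝓝 0) := by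
  rw [Metric.tendsto_nhds] at h ⊢
  intro ε hε
  obtain ⟨δ, hδ, hfδ⟩ := Metric.uniformContinuous_iff.1 hf ε hε
  filter_upwards [h δ hδ] with i hi
  rw [dist_zero_right, Real.norm_of_nonneg dist_nonneg] at hi ⊢
  exact hfδ hi

theorem tendsto_dist_tuple_rep_mk {n : ℕ} {Γ : Fin n → L.Srt} (v : ι → M.Tuple Γ) :
    Tendsto (fun i => dist (fun j => rep U (mk U fun i => v i j) i : M.Tuple Γ) (v i)) U
      (𝓝 0) := by
  rw [Metric.tendsto_nhds]
  intro ε hε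
  have h : ∀ j, ∀ᶠ i in U, dist (rep U (mk U fun i => v i j) i) (v i j) < ε := fun j =>
    (tendsto_dist_rep_mk U fun i => v i j).eventually_lt_const hε
  filter_upwards [Filter.eventually_all.2 h] with i hi
  rw [dist_zero_right, Real.norm_of_nonneg dist_nonneg]
  exact (dist_pi_lt_iff hε).2 hi

variable (M)

/-- The ultrapower of `M` along an ultrafilter that is not countably complete. -/
noncomputable def ultrapower (h : ι → ℕ) (hU : Tendsto h U atTop) : Structure L where
  carrier := Carrier U M
  complete s := completeSpace_carrier U M s h hU
  nonempty s := ⟨mk U fun _ => Classical.arbitrary _⟩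
  dist_le_one s a b := le_of_tendsto' (tendsto_dist_rep U a b) fun _ => M.dist_le_one _ _ _
  funMap f v := mk U fun i => M.funMap f fun j => rep U (v j) i
  predMap P v := ulim U fun i => M.predMap P fun j => rep U (v j) i
  funMap_unif f j ε hε v w hvw hd := by
    refine le_of_tendsto (tendsto_dist_mk U _ _) ?_
    filter_upwards [(tendsto_dist_rep U (v j) (w j)).eventually_lt_const hd] with i hi
    exact M.funMap_unif f j ε hε _ _ (fun k hk => by rw [hvw k hk]) hi
  predMap_unif P j ε hε v w hvw hd := by
    refine le_of_tendsto ((tendsto_ulim U _).dist (tendsto_ulim U _)) ?_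
    filter_upwards [(tendsto_dist_rep U (v j) (w j)).eventually_lt_const hd] with i hi
    exact M.predMap_unif P j ε hε _ _ (fun k hk => by rw [hvw k hk]) hi
  dist_unif_left s ε hε a a' b hd := by
    refine le_of_tendsto ((tendsto_dist_rep U a b).sub (tendsto_dist_rep U a' b)).abs ?_
    filter_upwards [(tendsto_dist_rep U a a').eventually_lt_const hd] with i hi
    exact M.dist_unif_left s ε hε _ _ _ hi
  dist_unif_right s ε hε a b b' hd := by
    refine le_of_tendsto ((tendsto_dist_rep U a b).sub (tendsto_dist_rep U a b')).abs ?_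
    filter_upwards [(tendsto_dist_rep U b b').eventually_lt_const hd] with i hi
    exact M.dist_unif_right s ε hε _ _ _ hi

variable {h : ι → ℕ} {hU : Tendsto h U atTop}

theorem realize_term {n : ℕ} {Γ : Fin n → L.Srt} (v : ι → M.Tuple Γ) {s : L.Srt}
    (t : Term L Γ s) :
    t.realize (ultrapower U M h hU) (fun j => mk U fun i => v i j) =
      mk U fun i => t.realize M (v i) := by
  induction t with
  | var j => rfl
  | func f ts ih =>
    simp only [Term.realize, ih]
    refine dist_eq_zero.1 (tendsto_nhds_unique (tendsto_dist_mk U _ _) ?_)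
    exact tendsto_dist_of_uniformContinuous U (M.uniformContinuous_funMap f)
      (tendsto_dist_tuple_rep_mk U fun i j => (ts j).realize M (v i))

theorem cons_mk {n : ℕ} {Γ : Fin n → L.Srt} {s : L.Srt} (a : ι → M.carrier s)
    (v : ι → M.Tuple Γ) :
    ((ultrapower U M h hU).cons (mk U a) fun j => mk U fun i => v i j) =
      fun j => mk U fun i => M.cons (a i) (v i) j := by
  funext j
  exact Fin.cases rfl (fun j => rfl) j

/-- The limit along `U` exists by compactness. It is at most each value in the ultrapower, by taking
representatives, and it is approached by choosing near-minimisers at each coordinate. -/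
theorem tendsto_iInf {n : ℕ} {Γ : Fin n → L.Srt} {s : L.Srt}
    (R : (ultrapower U M h hU).Tuple (Matrix.vecCons s Γ) → unitInterval)
    (r : M.Tuple (Matrix.vecCons s Γ) → unitInterval)
    (hR : ∀ v : ι → M.Tuple (Matrix.vecCons s Γ),
      Tendsto (fun i => r (v i)) U (𝓝 (R fun j => mk U fun i => v i j)))
    (v : ι → M.Tuple Γ) :
    Tendsto (fun i => ⨅ a : M.carrier s, r (M.cons a (v i))) U
      (𝓝 (⨅ a, R ((ultrapower U M h hU).cons a fun j => mk U fun i => v i j))) := by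
  have hl := tendsto_ulim U fun i => ⨅ a : M.carrier s, r (M.cons a (v i))
  convert hl using 2
  have hmk : ∀ a : ι → M.carrier s, Tendsto (fun i => r (M.cons (a i) (v i))) U
      (𝓝 (R ((ultrapower U M h hU).cons (mk U a) fun j => mk U fun i => v i j))) := fun a => by
    rw [cons_mk]
    exact hR fun i => M.cons (a i) (v i)
  apply le_antisymm
  · refine le_of_forall_gt_imp_ge_of_dense fun c hc => ?_
    have hex : ∀ i, ∃ a : M.carrier s, (⨅ a : M.carrier s, r (M.cons a (v i))) < c →
        r (M.cons a (v i)) < c := fun i => by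
      by_cases hi : (⨅ a : M.carrier s, r (M.cons a (v i))) < c
      · obtain ⟨a, ha⟩ := iInf_lt_iff.1 hi
        exact ⟨a, fun _ => ha⟩
      · exact ⟨Classical.arbitrary _, fun h => absurd h hi⟩
    choose a ha using hex
    refine (iInf_le _ (mk U a)).trans (le_of_tendsto (hmk a) ?_)
    filter_upwards [hl.eventually_lt_const hc] with i hi
    exact (ha i hi).le
  · refine le_iInf fun a => ?_
    have h1 := hmk (rep U a)
    rw [show mk U (rep U a) = a from mk_rep U a] at h1
    exact le_of_tendsto_of_tendsto' hl h1 fun i => iInf_le _ _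

/-- Łoś's theorem. -/
theorem tendsto_realize {n : ℕ} {Γ : Fin n → L.Srt} (ψ : Formula L F Γ) (v : ι → M.Tuple Γ) :
    Tendsto (fun i => ψ.realize M (v i)) U
      (𝓝 (ψ.realize (ultrapower U M h hU) fun j => mk U fun i => v i j)) := by
  induction ψ with
  | dist t₁ t₂ =>
    rw [tendsto_subtype_rng]
    simp only [Formula.realize, realize_term]
    exact tendsto_dist_mk U _ _
  | pred P ts =>
    simp only [Formula.realize, realize_term]
    have h1 := tendsto_ulim U fun i => M.predMap P fun j =>
      rep U (mk U fun i => (ts j).realize M (v i)) i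
    refine h1.congr_dist ?_
    exact tendsto_dist_of_uniformContinuous U (M.uniformContinuous_predMap P)
      (tendsto_dist_tuple_rep_mk U fun i j => (ts j).realize M (v i))
  | conn c ψ ih =>
    exact (c.1.continuous.tendsto _).comp (tendsto_pi_nhds.2 fun k => ih k v)
  | inf s ψ ih => exact tendsto_iInf U M _ _ ih v
  | sup s ψ ih =>
    have h1 := tendsto_iInf U M (h := h) (hU := hU)
      (fun w => unitInterval.symm (ψ.realize (ultrapower U M h hU) w))
      (fun w => unitInterval.symm (ψ.realize M w))
      (fun w => (unitInterval.continuous_symm.tendsto _).comp (ih w)) v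
    have h2 := (unitInterval.continuous_symm.tendsto _).comp h1
    simp only [← symm_iSup] at h2
    simp only [Function.comp_def, unitInterval.symm_symm] at h2
    exact h2

theorem models {T : Theory L F} (hM : M.Models T) : (ultrapower U M h hU).Models T := by
  intro ψ hψ
  have h1 := tendsto_realize U M (h := h) (hU := hU) ψ fun _ => M.nil
  rw [hM ψ hψ] at h1
  have h2 : (fun j => mk U fun _ => M.nil j) = (ultrapower U M h hU).nil :=
    funext fun j => j.elim0
  rw [h2] at h1
  exact tendsto_nhds_unique h1 tendsto_const_nhds

theorem tendsto_val₂ {σ τ : L.Srt} (φ : Formula L F ![σ, τ]) (a : ι → M.carrier σ)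
    (b : ι → M.carrier τ) :
    Tendsto (fun i => φ.val₂ M (a i) (b i)) U
      (𝓝 (φ.val₂ (ultrapower U M h hU) (mk U a) (mk U b))) := by
  have h1 := tendsto_realize U M (h := h) (hU := hU) φ fun i => M.cons (a i) (M.cons (b i) M.nil)
  have h2 : (fun j => mk U fun _ => M.nil j) = (ultrapower U M h hU).nil :=
    funext fun j => j.elim0
  rw [← cons_mk, ← cons_mk, h2] at h1
  exact h1

end Ultrapower

/-! ### Elementary substructures -/

/-- The family of sets `C` contains approximate witnesses for the quantifiers. -/
def TarskiVaught (F : Connectives) (M : Structure L) (C : ∀ s, Set (M.carrier s)) : Prop :=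
  ∀ ⦃n : ℕ⦄ ⦃Γ : Fin n → L.Srt⦄ ⦃s : L.Srt⦄ (ψ : Formula L F (Matrix.vecCons s Γ))
    (v : M.Tuple Γ), (∀ i, v i ∈ C (Γ i)) →
    (⨅ a, ψ.realize M (M.cons a v)) ∈ closure ((fun a => ψ.realize M (M.cons a v)) '' C s) ∧
    (⨆ a, ψ.realize M (M.cons a v)) ∈ closure ((fun a => ψ.realize M (M.cons a v)) '' C s)

namespace TarskiVaught

variable {M : Structure L} {C : ∀ s, Set (M.carrier s)}

theorem nonempty (h : TarskiVaught F M C) (s : L.Srt) : (C s).Nonempty := by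
  have h1 := (h (s := s) (Formula.dist (Term.var (Γ := Matrix.vecCons s ![]) 0)
    (Term.var (Γ := Matrix.vecCons s ![]) 0)) M.nil fun i => i.elim0).1
  exact (closure_nonempty_iff.1 ⟨_, h1⟩).of_image

/-- The test applied to the distance from `x` to `f(v)`, whose infimum is `0`, gives points of `C`
converging to `f(v)`. -/
theorem funMap_mem (h : TarskiVaught F M C) (hC : ∀ s, IsClosed (C s)) (f : L.Func)
    (v : ∀ i, M.carrier (L.funDom f i)) (hv : ∀ i, v i ∈ C (L.funDom f i)) :
    M.funMap f v ∈ C (L.funCod f) := by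
  let Γ := Matrix.vecCons (L.funCod f) (L.funDom f)
  let ψ : Formula L F Γ := .dist (Term.var (Γ := Γ) 0)
    (.func f fun i => Term.var (Γ := Γ) i.succ)
  have hψ : ∀ a, (ψ.realize M (M.cons a v) : ℝ) = dist a (M.funMap f v) := fun a => rfl
  have h0 : (⨅ a, ψ.realize M (M.cons a v)) = 0 := by
    refine le_antisymm ((iInf_le _ (M.funMap f v)).trans ?_) unitInterval.nonneg'
    rw [← Subtype.coe_le_coe, hψ, dist_self]
    rfl
  have h1 := (h ψ v hv).1
  rw [h0, Metric.mem_closure_iff] at h1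
  rw [← (hC _).closure_eq, Metric.mem_closure_iff]
  intro ε hε
  obtain ⟨_, ⟨a, ha, rfl⟩, hlt⟩ := h1 ε hε
  refine ⟨a, ha, ?_⟩
  rw [dist_comm, Subtype.dist_eq, hψ, Real.dist_eq, Set.Icc.coe_zero, sub_zero,
    abs_of_nonneg dist_nonneg] at hlt
  rwa [dist_comm]

/-- The structure induced on a closed family of sets that passes the Tarski–Vaught test. -/
def inducedStructure (h : TarskiVaught F M C) (hC : ∀ s, IsClosed (C s)) : Structure L where
  carrier s := C s
  complete s := (hC s).completeSpace_coe
  nonempty s := (h.nonempty s).to_subtype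
  dist_le_one s a b := M.dist_le_one s a b
  funMap f v := ⟨M.funMap f fun i => v i, h.funMap_mem hC f _ fun i => (v i).2⟩
  predMap P v := M.predMap P fun i => v i
  funMap_unif f i ε hε v w hvw hd := M.funMap_unif f i ε hε _ _ (fun j hj => by rw [hvw j hj]) hd
  predMap_unif P i ε hε v w hvw hd :=
    M.predMap_unif P i ε hε _ _ (fun j hj => by rw [hvw j hj]) hd
  dist_unif_left s ε hε a a' b hd := M.dist_unif_left s ε hε a a' b hd
  dist_unif_right s ε hε a b b' hd := M.dist_unif_right s ε hε a b b' hd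

theorem realize_term (h : TarskiVaught F M C) (hC : ∀ s, IsClosed (C s)) {n : ℕ}
    {Γ : Fin n → L.Srt} (v : (h.inducedStructure hC).Tuple Γ) {s : L.Srt} (t : Term L Γ s) :
    (t.realize (h.inducedStructure hC) v).1 = t.realize M fun i => (v i).1 := by
  induction t with
  | var i => rfl
  | func f ts ih =>
    simp only [Term.realize, ← ih]
    rfl

theorem cons_val (h : TarskiVaught F M C) (hC : ∀ s, IsClosed (C s)) {n : ℕ}
    {Γ : Fin n → L.Srt} (v : (h.inducedStructure hC).Tuple Γ) {s : L.Srt} (a : C s) :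
    (fun i => ((h.inducedStructure hC).cons (s := s) a v i).1) = M.cons a.1 fun i => (v i).1 := by
  funext i
  exact Fin.cases rfl (fun i => rfl) i

/-- At a quantifier, the value over `M` is a limit of values at points of `C`, so restricting the
range to `C` changes neither infima nor suprema. -/
theorem realize_formula (h : TarskiVaught F M C) (hC : ∀ s, IsClosed (C s)) {n : ℕ}
    {Γ : Fin n → L.Srt} (ψ : Formula L F Γ) (v : (h.inducedStructure hC).Tuple Γ) :
    ψ.realize (h.inducedStructure hC) v = ψ.realize M fun i => (v i).1 := by
  induction ψ with
  | dist t₁ t₂ =>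
    apply Subtype.ext
    simp only [Formula.realize, ← realize_term h hC]
    rfl
  | pred P ts =>
    simp only [Formula.realize, ← realize_term h hC]
    rfl
  | conn c ψ ih => simp only [Formula.realize, ih]
  | inf s ψ ih =>
    simp only [Formula.realize, ih]
    apply le_antisymm
    · refine (closure_minimal ?_ isClosed_Ici : _ ⊆ Ici (⨅ a : C s, ψ.realize M fun i =>
        ((h.inducedStructure hC).cons (s := s) a v i).1)) (h ψ (fun i => (v i).1) fun i => (v i).2).1
      rintro _ ⟨a, ha, rfl⟩
      have h1 := iInf_le (fun a : C s => ψ.realize M fun i =>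
        ((h.inducedStructure hC).cons (s := s) a v i).1) ⟨a, ha⟩
      rwa [cons_val h hC v ⟨a, ha⟩] at h1
    · refine le_iInf fun a => ?_
      rw [cons_val h hC v a]
      exact iInf_le _ a.1
  | sup s ψ ih =>
    simp only [Formula.realize, ih]
    apply le_antisymm
    · refine iSup_le fun a => ?_
      rw [cons_val h hC v a]
      exact le_iSup (fun a => ψ.realize M (M.cons a fun i => (v i).1)) a.1
    · refine (closure_minimal ?_ isClosed_Iic : _ ⊆ Iic (⨆ a : C s, ψ.realize M fun i =>
        ((h.inducedStructure hC).cons (s := s) a v i).1)) (h ψ (fun i => (v i).1) fun i => (v i).2).2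
      rintro _ ⟨a, ha, rfl⟩
      have h1 := le_iSup (fun a : C s => ψ.realize M fun i =>
        ((h.inducedStructure hC).cons (s := s) a v i).1) ⟨a, ha⟩
      rwa [cons_val h hC v ⟨a, ha⟩] at h1

end TarskiVaught

/-! ### The downward Löwenheim–Skolem theorem -/

theorem exists_dist_iInf_lt {X : Type*} [Nonempty X] (f : X → unitInterval) {ε : ℝ}
    (hε : 0 < ε) : ∃ a, dist (⨅ a, f a) (f a) < ε := by
  obtain ⟨_, ⟨a, rfl⟩, h⟩ := Metric.mem_closure_iff.1
    ((isGLB_iInf (f := f)).mem_closure (range_nonempty f)) ε hε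
  exact ⟨a, h⟩

theorem exists_dist_iSup_lt {X : Type*} [Nonempty X] (f : X → unitInterval) {ε : ℝ}
    (hε : 0 < ε) : ∃ a, dist (⨆ a, f a) (f a) < ε := by
  obtain ⟨_, ⟨a, rfl⟩, h⟩ := Metric.mem_closure_iff.1
    ((isLUB_iSup (f := f)).mem_closure (range_nonempty f)) ε hε
  exact ⟨a, h⟩

/-- An element minimising a formula up to `1 / (k + 1)`. -/
noncomputable def infWitness (M : Structure L) {n : ℕ} {Γ : Fin n → L.Srt} {s : L.Srt}
    (ψ : Formula L F (Matrix.vecCons s Γ)) (v : M.Tuple Γ) (k : ℕ) : M.carrier s :=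
  (exists_dist_iInf_lt (fun a => ψ.realize M (M.cons a v))
    (Nat.one_div_pos_of_nat (α := ℝ) (n := k))).choose

/-- An element maximising a formula up to `1 / (k + 1)`. -/
noncomputable def supWitness (M : Structure L) {n : ℕ} {Γ : Fin n → L.Srt} {s : L.Srt}
    (ψ : Formula L F (Matrix.vecCons s Γ)) (v : M.Tuple Γ) (k : ℕ) : M.carrier s :=
  (exists_dist_iSup_lt (fun a => ψ.realize M (M.cons a v))
    (Nat.one_div_pos_of_nat (α := ℝ) (n := k))).choose

theorem dist_infWitness_lt (M : Structure L) {n : ℕ} {Γ : Fin n → L.Srt} {s : L.Srt}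
    (ψ : Formula L F (Matrix.vecCons s Γ)) (v : M.Tuple Γ) (k : ℕ) :
    dist (⨅ a, ψ.realize M (M.cons a v)) (ψ.realize M (M.cons (infWitness M ψ v k) v)) <
      1 / ((k : ℝ) + 1) :=
  (exists_dist_iInf_lt (fun a => ψ.realize M (M.cons a v))
    (Nat.one_div_pos_of_nat (α := ℝ) (n := k))).choose_spec

theorem dist_supWitness_lt (M : Structure L) {n : ℕ} {Γ : Fin n → L.Srt} {s : L.Srt}
    (ψ : Formula L F (Matrix.vecCons s Γ)) (v : M.Tuple Γ) (k : ℕ) :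
    dist (⨆ a, ψ.realize M (M.cons a v)) (ψ.realize M (M.cons (supWitness M ψ v k) v)) <
      1 / ((k : ℝ) + 1) :=
  (exists_dist_iSup_lt (fun a => ψ.realize M (M.cons a v))
    (Nat.one_div_pos_of_nat (α := ℝ) (n := k))).choose_spec

/-- One step of the construction of a Skolem hull. -/
def skolemStep (F : Connectives) (M : Structure L) (D : ∀ s, Set (M.carrier s)) (s : L.Srt) :
    Set (M.carrier s) :=
  D s ∪ (range (fun x : ParamCode F M D s × ℕ =>
      infWitness M x.1.2.2.1 (fun i => x.1.2.2.2 i) x.2) ∪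
    range (fun x : ParamCode F M D s × ℕ =>
      supWitness M x.1.2.2.1 (fun i => x.1.2.2.2 i) x.2))

/-- The steps of the construction of a Skolem hull. -/
def skolemSeq (F : Connectives) (M : Structure L) (D : ∀ s, Set (M.carrier s)) :
    ℕ → ∀ s, Set (M.carrier s)
  | 0 => D
  | n + 1 => skolemStep F M (skolemSeq F M D n)

theorem skolemSeq_mono (M : Structure L) (D : ∀ s, Set (M.carrier s)) (s : L.Srt) :
    Monotone fun n => skolemSeq F M D n s :=
  monotone_nat_of_le_succ fun _ => subset_union_left

theorem mk_skolemSeq_le {M : Structure L} {D : ∀ s, Set (M.carrier s)} {κ : Cardinal.{u}}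
    (hκ : langCard L F ≤ κ) (hD : ∀ s, Cardinal.mk (D s) ≤ κ) (n : ℕ) (s : L.Srt) :
    Cardinal.mk (skolemSeq F M D n s) ≤ κ := by
  have h0 := (aleph0_le_langCard F s).trans hκ
  induction n generalizing s with
  | zero => exact hD s
  | succ n ih =>
    have h1 : Cardinal.mk (ParamCode F M (skolemSeq F M D n) s × ℕ) ≤ κ :=
      mk_prod_nat_le h0 (mk_paramCode_le hκ ih)
    refine (Cardinal.mk_union_le _ _).trans (Cardinal.add_le_of_le h0 (ih s) ?_)
    refine (Cardinal.mk_union_le _ _).trans (Cardinal.add_le_of_le h0 ?_ ?_) <;>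
      exact Cardinal.mk_range_le.trans h1

/-- Parameters in the closure are moved, by uniform continuity, to a single finite stage `N`; the
next stage contains near-optimal witnesses for them. -/
theorem tarskiVaught_closure_skolem (F : Connectives) (M : Structure L)
    (D : ∀ s, Set (M.carrier s)) :
    TarskiVaught F M fun s => closure (⋃ n, skolemSeq F M D n s) := by
  intro n Γ s ψ v hv
  have key : ∀ ε > 0, ∃ w : M.Tuple Γ, (∃ N, ∀ i, w i ∈ skolemSeq F M D N (Γ i)) ∧
      ∀ a : M.carrier s, dist (ψ.realize M (M.cons a v)) (ψ.realize M (M.cons a w)) ≤ ε := by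
    intro ε hε
    obtain ⟨δ, hδ, hψ⟩ := Metric.uniformContinuous_iff.1 (ψ.uniformContinuous_realize M) ε hε
    choose w hw hd using fun i => Metric.mem_closure_iff.1 (hv i) δ hδ
    refine ⟨w, ?_, fun a => (hψ ((M.dist_cons_cons a v w).trans_lt
      ((dist_pi_lt_iff hδ).2 hd))).le⟩
    choose N hN using fun i => mem_iUnion.1 (hw i)
    exact ⟨Finset.univ.sup N, fun i =>
      skolemSeq_mono M D (Γ i) (Finset.le_sup (Finset.mem_univ i)) (hN i)⟩
  constructor
  · rw [Metric.mem_closure_iff]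
    intro ε hε
    obtain ⟨w, ⟨N, hN⟩, hw⟩ := key (ε / 4) (by positivity)
    obtain ⟨k, hk⟩ := exists_nat_one_div_lt (by positivity : 0 < ε / 4)
    refine ⟨_, ⟨infWitness M ψ w k, subset_closure (mem_iUnion.2 ⟨N + 1, Or.inr (Or.inl
      ⟨(⟨n, Γ, ψ, fun i => ⟨w i, hN i⟩⟩, k), rfl⟩)⟩), rfl⟩, ?_⟩
    have h1 := dist_infWitness_lt M ψ w k
    have h2 := hw (infWitness M ψ w k)
    rw [dist_comm] at h2
    refine (dist_triangle4 _ (⨅ a, ψ.realize M (M.cons a w))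
      (ψ.realize M (M.cons (infWitness M ψ w k) w)) _).trans_lt ?_
    linarith [dist_iInf_le hw]
  · rw [Metric.mem_closure_iff]
    intro ε hε
    obtain ⟨w, ⟨N, hN⟩, hw⟩ := key (ε / 4) (by positivity)
    obtain ⟨k, hk⟩ := exists_nat_one_div_lt (by positivity : 0 < ε / 4)
    refine ⟨_, ⟨supWitness M ψ w k, subset_closure (mem_iUnion.2 ⟨N + 1, Or.inr (Or.inr
      ⟨(⟨n, Γ, ψ, fun i => ⟨w i, hN i⟩⟩, k), rfl⟩)⟩), rfl⟩, ?_⟩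
    have h1 := dist_supWitness_lt M ψ w k
    have h2 := hw (supWitness M ψ w k)
    rw [dist_comm] at h2
    refine (dist_triangle4 _ (⨆ a, ψ.realize M (M.cons a w))
      (ψ.realize M (M.cons (supWitness M ψ w k) w)) _).trans_lt ?_
    linarith [dist_iSup_le hw]

theorem mk_srt_le_langCard (L : Signature.{u}) (F : Connectives) :
    Cardinal.mk L.Srt ≤ langCard L F := by
  refine Cardinal.mk_le_of_injective (f := fun s =>
    (⟨1, fun _ => s, .dist (Term.var (Γ := fun _ : Fin 1 => s) 0)
      (Term.var (Γ := fun _ : Fin 1 => s) 0)⟩ :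
      Σ n : ℕ, Σ Γ : Fin n → L.Srt, Formula L F Γ)) fun s t h => ?_
  have h1 := (Sigma.mk.inj_iff.1 (eq_of_heq (Sigma.mk.inj_iff.1 h).2)).1
  exact congrFun h1 0

/-- The downward Löwenheim–Skolem theorem. -/
theorem exists_elemEmbedding_density_le (F : Connectives) (M : Structure L) {κ : Cardinal.{u}}
    (hκ : langCard L F ≤ κ) {τ : L.Srt} (B : Set (M.carrier τ)) (hB : Cardinal.mk B ≤ κ) :
    ∃ (N : Structure L) (e : ElemEmbedding F N M), N.density ≤ κ ∧ B ⊆ range (e.toFun τ) := by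
  have h0 := (aleph0_le_langCard F τ).trans hκ
  -- This is `B` in the sort `τ` and empty in every other sort, written without transporting along
  -- equalities of sorts.
  let D : ∀ s, Set (M.carrier s) := fun s =>
    {x | ∃ b : B, (⟨s, x⟩ : Σ s, M.carrier s) = ⟨τ, b⟩}
  have hD : ∀ s, Cardinal.mk (D s) ≤ κ := fun s => by
    refine (Cardinal.mk_le_of_injective (f := fun x : D s => x.2.choose) fun x y h => ?_).trans hB
    have h1 : (⟨s, x.1⟩ : Σ s, M.carrier s) = ⟨s, y.1⟩ := by
      rw [x.2.choose_spec, y.2.choose_spec]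
      exact congrArg (fun b : B => (⟨τ, b⟩ : Σ s, M.carrier s)) h
    exact Subtype.ext (eq_of_heq (Sigma.mk.inj_iff.1 h1).2)
  have htv := tarskiVaught_closure_skolem F M D
  have hC : ∀ s, IsClosed (closure (⋃ n, skolemSeq F M D n s)) := fun s => isClosed_closure
  refine ⟨htv.inducedStructure hC, ⟨fun s x => x.1, fun ψ v => (htv.realize_formula hC ψ v).symm⟩,
    ?_, fun b hb => ⟨⟨b, subset_closure (mem_iUnion.2 ⟨0, ⟨b, hb⟩, rfl⟩)⟩, rfl⟩⟩
  refine (Cardinal.sum_le_sum _ (fun _ => κ) fun s => ?_).trans ?_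
  · have hdense : Dense (Subtype.val ⁻¹' (⋃ n, skolemSeq F M D n s) :
        Set (closure (⋃ n, skolemSeq F M D n s))) := by
      rw [Subtype.dense_iff, Subtype.image_preimage_coe,
        inter_eq_self_of_subset_right subset_closure]
    refine (density_le_mk hdense).trans ?_
    refine (Cardinal.mk_preimage_of_injective _ _ Subtype.val_injective).trans ?_
    exact mk_iUnion_nat_le h0 fun n => mk_skolemSeq_le hκ hD n s
  · rw [Cardinal.sum_const']
    exact Cardinal.mul_le_of_le h0 ((mk_srt_le_langCard L F).trans hκ) le_rfl

theorem ElemEmbedding.models {M N : Structure L} (e : ElemEmbedding F M N) {T : Theory L F}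
    (hN : N.Models T) : M.Models T := by
  intro ψ hψ
  rw [← e.map_formula ψ M.nil, ← hN ψ hψ]
  congr 1
  exact funext fun i => i.elim0

/-! ### Linear orders with small separating sets -/

/-- For every infinite cardinal `κ` there is a linear order with a subset `A` of size greater than
`κ` any two points of which are separated by a member of a set `B` of size at most `κ`. -/
theorem exists_linearOrder_separated {κ : Cardinal.{u}} (hκ : Cardinal.aleph0 ≤ κ) :
    ∃ (K : Type u) (_ : LinearOrder K) (A B : Set K), κ < Cardinal.mk A ∧ Cardinal.mk B ≤ κ ∧
      ∀ x ∈ A, ∀ y ∈ A, x < y → ∃ b ∈ B, x < b ∧ b < y := by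
  classical
  let S : Set Cardinal.{u} := {μ | κ < 2 ^ μ}
  have hS : S.Nonempty := ⟨κ, Cardinal.cantor κ⟩
  -- Minimality of `μ` bounds by `κ` the number of binary sequences indexed by a proper initial
  -- segment of `ι`, while there are more than `κ` full branches.
  let μ := sInf S
  have hμ : κ < 2 ^ μ := csInf_mem hS
  have hμκ : μ ≤ κ := csInf_le' (Cardinal.cantor κ)
  let ι := μ.ord.ToType
  have hι : Cardinal.mk ι = μ := by rw [Cardinal.mk_toType, Cardinal.card_ord]
  have hIio : ∀ i : ι, (2 : Cardinal.{u}) ^ Cardinal.mk (Iio i) ≤ κ := fun i =>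
    not_lt.1 fun h => ((Cardinal.mk_Iio_lt i (by simp [ι])).trans_eq hι).not_ge (csInf_le' h)
  let a : (ι → Bool) → Lex (ι → Fin 3) := fun g => toLex fun i => if g i then 2 else 0
  -- A binary initial segment, then the middle digit `1`, then zeros. It lies strictly between two
  -- branches that share this segment and first differ at `x.1`.
  let b : (Σ i : ι, Iio i → Bool) → Lex (ι → Fin 3) := fun x => toLex fun j =>
    if h : j < x.1 then if x.2 ⟨j, h⟩ then 2 else 0 else if j = x.1 then 1 else 0
  have ha : Function.Injective a := fun g g' h => by
    funext i
    have h1 : (if g i then (2 : Fin 3) else 0) = if g' i then 2 else 0 := congrFun h i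
    cases hg : g i <;> cases hg' : g' i <;> simp_all
  refine ⟨Lex (ι → Fin 3), inferInstance, range a, range b, ?_, ?_, ?_⟩
  · rw [Cardinal.mk_range_eq a ha]
    simpa [hι] using hμ
  · refine Cardinal.mk_range_le.trans (mk_sigma_le hκ (hι.trans_le hμκ) fun i => ?_)
    simpa using hIio i
  · rintro _ ⟨g, rfl⟩ _ ⟨g', rfl⟩ ⟨i, hlt, hi⟩
    refine ⟨b ⟨i, fun j => g j⟩, ⟨_, rfl⟩, ⟨i, fun j hj => ?_, ?_⟩, ⟨i, fun j hj => ?_, ?_⟩⟩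
    · show (if g j then (2 : Fin 3) else 0) =
        if h : j < i then if g j then 2 else 0 else if j = i then 1 else 0
      rw [dif_pos hj]
    · show (if g i then (2 : Fin 3) else 0) <
        if h : i < i then if g i then 2 else 0 else if i = i then 1 else 0
      have h1 : (if g i then (2 : Fin 3) else 0) < if g' i then 2 else 0 := hi
      cases hg : g i <;> cases hg' : g' i <;> simp_all
    · have h1 : (if g j then (2 : Fin 3) else 0) = if g' j then 2 else 0 := hlt j hj
      show (if h : j < i then if g j then (2 : Fin 3) else 0 else if j = i then 1 else 0) =
        if g' j then 2 else 0
      rw [dif_pos hj, h1]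
    · show (if h : i < i then if g i then (2 : Fin 3) else 0 else if i = i then 1 else 0) <
        if g' i then 2 else 0
      have h1 : (if g i then (2 : Fin 3) else 0) < if g' i then 2 else 0 := hi
      cases hg : g i <;> cases hg' : g' i <;> simp_all

/-! ### Many types in the unstable case -/

/-- If `φ` is unstable, then it has the order property along any infinite linear order. -/
theorem exists_model_order {T : Theory L F} {σ τ : L.Srt} {φ : Formula L F ![σ, τ]}
    (hφ : ¬ Stable T φ) :
    ∃ (r s : unitInterval) (δ : ℝ), 0 < δ ∧ 3 * δ ≤ dist r s ∧
      ∀ (K : Type u) [LinearOrder K] [Infinite K], ∃ (N : Structure L) (a : K → N.carrier σ)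
        (b : K → N.carrier τ), N.Models T ∧ ∀ x y, x < y →
          dist (φ.val₂ N (a x) (b y)) r ≤ δ ∧ dist (φ.val₂ N (a y) (b x)) s ≤ δ := by
  simp only [Stable, EpsStable] at hφ
  push Not at hφ
  obtain ⟨ε, hε, M, hM, a, b, hab⟩ := hφ
  obtain ⟨⟨r, s⟩, k, hk, hrs⟩ := exists_strictMono_dist_lt
    (fun i j => (φ.val₂ M (a i) (b j), φ.val₂ M (a j) (b i))) (by positivity : 0 < ε / 5)
  have hr : ∀ i j, i < j → dist (φ.val₂ M (a (k i)) (b (k j))) r < ε / 5 := fun i j hij =>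
    (le_max_left _ _).trans_lt (hrs i j hij)
  have hs : ∀ i j, i < j → dist (φ.val₂ M (a (k j)) (b (k i))) s < ε / 5 := fun i j hij =>
    (le_max_right _ _).trans_lt (hrs i j hij)
  -- Two errors of `ε / 5` subtracted from a gap of `ε` leave `3ε / 5`, that is `3δ`.
  refine ⟨r, s, ε / 5, by positivity, ?_, fun K _ _ => ?_⟩
  · have h1 := hab (k 0) (k 1) (hk zero_lt_one)
    rw [← Real.dist_eq, ← Subtype.dist_eq] at h1
    have h2 := hr 0 1 zero_lt_one
    have h3 := hs 0 1 zero_lt_one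
    rw [dist_comm] at h3
    have h4 := dist_triangle4 (φ.val₂ M (a (k 0)) (b (k 1))) r s (φ.val₂ M (a (k 1)) (b (k 0)))
    linarith
  · classical
    let U : Ultrafilter (Finset K) := Ultrafilter.of atTop
    have hU : (U : Filter (Finset K)) ≤ atTop := Ultrafilter.of_le _
    have hcard : Tendsto (Finset.card : Finset K → ℕ) U atTop :=
      tendsto_card_atTop_atTop.mono_left hU
    -- Each finite `S` maps `K` monotonically into `ℕ`; the map is strict at `x < y` as soon as `x ∈
    -- S`, which holds along `U`.
    let rank : K → Finset K → ℕ := fun x S => (S.filter (· < x)).card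
    have hrank : ∀ x y, x < y → ∀ᶠ S in U, rank x S < rank y S := fun x y hxy => by
      refine hU ?_
      filter_upwards [eventually_ge_atTop {x}] with S hS
      refine Finset.card_lt_card (Finset.ssubset_iff_of_subset ?_ |>.2 ⟨x, ?_, ?_⟩)
      · exact Finset.monotone_filter_right S fun z _ hz => lt_trans hz hxy
      · exact Finset.mem_filter.2 ⟨hS (Finset.mem_singleton_self x), hxy⟩
      · simp
    refine ⟨Ultrapower.ultrapower U M Finset.card hcard,
      fun x => Ultrapower.mk U fun S => a (k (rank x S)),
      fun x => Ultrapower.mk U fun S => b (k (rank x S)),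
      Ultrapower.models U M hM, fun x y hxy => ⟨?_, ?_⟩⟩
    · refine le_of_tendsto ((Ultrapower.tendsto_val₂ U M φ _ _).dist tendsto_const_nhds) ?_
      filter_upwards [hrank x y hxy] with S hS
      exact (hr _ _ hS).le
    · refine le_of_tendsto ((Ultrapower.tendsto_val₂ U M φ _ _).dist tendsto_const_nhds) ?_
      filter_upwards [hrank x y hxy] with S hS
      exact (hs _ _ hS).le

theorem exists_model_many_types {T : Theory L F} {σ τ : L.Srt} {φ : Formula L F ![σ, τ]}
    (hφ : ¬ Stable T φ) {κ : Cardinal.{u}} (hκ : langCard L F ≤ κ) :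
    ∃ M : Structure L, M.Models T ∧ M.density ≤ κ ∧ κ < ContLogic.density (PhiType φ M) := by
  have h0 := (aleph0_le_langCard F σ).trans hκ
  obtain ⟨r, s, δ, hδ, hrs, h⟩ := exists_model_order hφ
  obtain ⟨K, _, A, B, hA, hB, hAB⟩ := exists_linearOrder_separated h0
  have : Infinite K := Cardinal.infinite_iff.2
    ((h0.trans hA.le).trans (Cardinal.mk_set_le A))
  obtain ⟨N, a, b, hN, hab⟩ := h K
  obtain ⟨M, e, hMκ, hM⟩ := exists_elemEmbedding_density_le F N hκ (b '' B)
    (Cardinal.mk_image_le.trans hB)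
  refine ⟨M, e.models hN, hMκ, hA.trans_le ?_⟩
  have hlt : ∀ x y : A, x < y →
      δ ≤ dist (PhiType.ofExt φ e (a x)) (PhiType.ofExt φ e (a y)) := fun x y hxy => by
    -- At the parameter `b c`, the type of `a x` has value near `r` and that of `a y` near `s`, so
    -- they differ by at least `3δ - 2δ`.
    obtain ⟨c, hcB, hxc, hcy⟩ := hAB x x.2 y y.2 hxy
    obtain ⟨c', hc'⟩ := hM ⟨c, hcB, rfl⟩
    refine le_trans ?_ (PhiType.dist_val_le _ _ c')
    rw [PhiType.val_ofExt, PhiType.val_ofExt, hc']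
    have h1 := (hab x c hxc).1
    have h2 := (hab c y hcy).2
    rw [dist_comm] at h1
    linarith [dist_triangle4 r (φ.val₂ N (a x) (b c)) (φ.val₂ N (a y) (b c)) s]
  refine mk_le_density_of_separated hδ (fun x : A => PhiType.ofExt φ e (a x)) fun x y hxy => ?_
  obtain h1 | h1 := lt_or_gt_of_ne hxy
  · exact hlt x y h1
  · rw [dist_comm]
    exact hlt y x h1

end ContLogic

theorem mainTheorem3 (L : ContLogic.Signature.{u}) (F : ContLogic.Connectives) (hF : F.Full)
    (T : ContLogic.Theory L F) (σ τ : L.Srt) (φ : ContLogic.Formula L F ![σ, τ]) :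
    List.TFAE [
      ContLogic.Stable T φ,
      ∀ M : ContLogic.Structure L, M.Models T → ∀ p : ContLogic.PhiType φ M, p.IsDefinable,
      ∀ M : ContLogic.Structure L, M.Models T →
        ContLogic.density (ContLogic.PhiType φ M) ≤ M.density,
      ∃ lam : Cardinal.{u}, ContLogic.langCard L F ≤ lam ∧
        ∀ M : ContLogic.Structure L, M.Models T → M.density ≤ lam →
          ContLogic.density (ContLogic.PhiType φ M) ≤ lam] := by
  tfae_have 1 → 2 := fun h M hM p => h.isDefinable hF hM p
  tfae_have 1 → 3 := fun h M hM => h.density_phiType_le hF hM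
  -- Counting defining formulae gives a bound only above `|T|`, so this leads to 4 rather than
  -- directly to 3.
  tfae_have 2 → 4 := fun h => ⟨_, le_rfl, fun M hM hMd =>
    ContLogic.density_phiType_le_of_isDefinable (h M hM) le_rfl hMd⟩
  tfae_have 3 → 4 := fun h => ⟨_, le_rfl, fun M hM hMd => (h M hM).trans hMd⟩
  tfae_have 4 → 1 := by
    rintro ⟨κ, hκ, h⟩
    by_contra hφ
    obtain ⟨M, hM, hMκ, hlt⟩ := ContLogic.exists_model_many_types hφ hκ
    exact hlt.not_ge (h M hM hMκ)
  tfae_finish
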